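/- **Setting.** Let $X,Y$ be Banach spaces (both complex or both real), and let $A,B$ be closed linear operators from $X$ into $Y$ with dense domains $D_A,D_B$, where $D_A\subseteq D_B$, $D:=D_A\neq\{0\}$ (with the norm of $X$), $\operatorname{range}(A)$ is closed and $n:=\dim\ker A<\infty$. Suppose that $\lambda A+B$ is a regular pencil of index $\nu$. For $\nu\ge1$ this means that for all complex $\lambda$ of large modulus $R(\lambda)=(\lambda A+B)^{-1}$ exists as a bounded operator on $Y$, and $\nu$ is the least positive integer with $\|R(\lambda)\|\le C|\lambda|^{\nu-1}$ for all large $|\lambda|$ (for real spaces, $R(\lambda)$ is formed with the complexifications). For $\nu=0$ it means that $A$ has a bounded inverse defined on $Y$. Let $f\in C(\mathbb R_+\times D,Y)$, $\mathbb R_+=[0,\infty)$. **Root systems and projectors.** A root system consists of $\varphi_i^j\in D$ and $q_i^j\in Y^*$, $1\le i\le n$, $1\le j\le m_i$ ($m_i\ge 1$), such that $\varphi_1^1,\dots,\varphi_n^1$ is a basis of $\ker A$; $A\varphi_i^j=-B\varphi_i^{j-1}$ for $2\le j\le m_i$; $\langle Ax,q_i^{m_i}\rangle=0$ and $\langle Ax,q_i^j\rangle=-\langle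 Bx,q_i^{j+1}\rangle$ for $x\in D$, $1\le j<m_i$; and $\langle B\varphi_i^j,q_k^l\rangle=\delta_{ik}\delta_{jl}$. Given such a system, put for $x\in D$, $y\in Y$ $$P_{20}x=\sum_i\langle Bx,q_i^1\rangle\varphi_i^1,\qquad P_{2\Sigma}x=\sum_i\sum_{j=2}^{m_i}\langle Bx,q_i^j\rangle\varphi_i^j,\qquad P_1=I-P_{20}-P_{2\Sigma},$$ $$Q_{2*}y=\sum_i\langle y,q_i^{m_i}\rangle B\varphi_i^{m_i},\qquad Q_{2\Sigma}y=\sum_i\sum_{j=1}^{m_i-1}\langle y,q_i^j\rangle B\varphi_i^j,\qquad Q_1=I-Q_{2\Sigma}-Q_{2*}.$$ Let $D_1=P_1D$, $D_{20}=\ker A$, $D_{2\Sigma}=\operatorname{span}\{\varphi_i^j: j\ge2\}$, $Y_1=Q_1Y$, $Y_{2*}=\operatorname{span}\{B\varphi_i^{m_i}\}$, $Y_{2\Sigma}=\operatorname{span}\{B\varphi_i^j:j<m_i\}$, $W=Y_1\dotplus Y_{2\Sigma}$, and $\widetilde A=A+\sum_i\langle B\,\cdot,q_i^1\rangle B\varphi_i^{m_i}$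 on $D$. For $x=x_1+x_{2\Sigma}+x_{20}$ with components in $D_1,D_{2\Sigma},D_{20}$ put $$F_{2*}(t,x_1,x_{2\Sigma},x_{20})=Q_{2*}f(t,x)-Q_{2*}B(x_{20}+x_{2\Sigma}),\qquad L_0=\{(t,x)\in\mathbb R_+\times D: Q_{2*}[f(t,x)-Bx]=0\}.$$ A solution of $\frac{d}{dt}[Ax]+Bx=f(t,x)$ on an interval $J\subseteq\mathbb R_+$ is a function $x\in C(J,X)$ with values in $D$ and $Ax\in C^1(J,Y)$ (one-sided derivatives at end points) that satisfies the equation on $J$. A maximal interval of existence $[t_0,t_{\max})$, $t_0<t_{\max}\le\infty$, of a solution in a set $M$ is one such that the solution has no extension to the right that remains a solution with values in $M$. **Theorem.** Root systems exist, and for each of them the following holds. *(a)* Let $\widetilde M\subseteq W$ be open in $W$, $M_{20}\subseteq D_{20}$ and $M_{1,2\Sigma}=\widetilde A^{-1}\widetilde M$, and suppose: 1. For each $t\in\mathbb R_+$ and $x_1+x_{2\Sigma}\in M_{1,2\Sigma}$ there is a unique $x_{20}\in M_{20}$ with $(t,x_1+x_{2\Sigma}+x_{20})\in L_0$. Moreover,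 the points $(t,x)\in L_0$ with $x_1+x_{2\Sigma}\in M_{1,2\Sigma}$ and $x_{20}\in M_{20}$ form a relatively open subset of $\{(t,x)\in L_0: x_1+x_{2\Sigma}\in M_{1,2\Sigma}\}$, for the norm $\|x_1\|+\|x_{2\Sigma}\|+\|x_{20}\|$ (this is automatic if $M_{20}$ is open in $D_{20}$, in particular if $M_{20}=D_{20}$). 2. Either (2') or (2'') holds: * (2') $f$ is locally Lipschitz with respect to $x$ on $\mathbb R_+\times D$, and for each $(t',x')\in L_0$ with $x_1'+x_{2\Sigma}'\in M_{1,2\Sigma}$, $x_{20}'\in M_{20}$ there are a bounded operator $W_{t',x'}:D_{20}\to Y_{2*}$ with bounded inverse and a function $q(\delta,\varepsilon)$ with $\lim_{\delta,\varepsilon\to0}q(\delta,\varepsilon)<\|W_{t',x'}^{-1}\|^{-1}$ (no restriction if $D_{20}=\{0\}$) such that, for all sufficiently small $\delta,\varepsilon>0$, $$\|F_{2*}(t,x_1,x_{2\Sigma},u)-F_{2*}(t,x_1,x_{2\Sigma},v)-W_{t',x'}[u-v]\|\le q(\delta,\varepsilon)\|u-v\|$$ whenever $t\in\mathbb R_+$,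 $x_1\in D_1$, $x_{2\Sigma}\in D_{2\Sigma}$ lie in the $\delta$-neighbourhoods of $t',x_1',x_{2\Sigma}'$ and $u,v\in D_{20}$ lie in the $\varepsilon$-neighbourhood of $x_{20}'$; * (2'') $f$ has a continuous Fréchet partial derivative with respect to $x$ on $\mathbb R_+\times D$, and for each $(t',x')$ as in (2') the operator $[Q_{2*}\partial_xf(t',x')-Q_{2*}B]|_{D_{20}}:D_{20}\to Y_{2*}$ has a bounded inverse. Then for each $(t_0,x_0)\in L_0$ with $(P_1+P_{2\Sigma})x_0\in M_{1,2\Sigma}$ and $P_{20}x_0\in M_{20}$ there is a $t_{\max}\le\infty$ such that the initial value problem $\frac{d}{dt}[Ax]+Bx=f(t,x)$, $x(t_0)=x_0$ has a unique solution in $M_{1,2\Sigma}\dotplus M_{20}$ on the maximal interval of existence $[t_0,t_{\max})$; every solution of this problem in $M_{1,2\Sigma}\dotplus M_{20}$ on an interval with left end point $t_0$ is a restriction of it. *(b)* If the conditions in (a) hold with $\widetilde M=W$ and $M_{20}=D_{20}$, then for each $(t_0,x_0)\in L_0$ there is a $t_{\max}\le\infty$ such that the initial value problem has a unique solution on the maximal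 interval of existence $[t_0,t_{\max})$. -/

import Mathlib

open Set Filter Topology

namespace ADAE

section Pencil

variable {𝕜 X Y : Type*} [RCLike 𝕜]
  [NormedAddCommGroup X] [NormedSpace 𝕜 X] [NormedAddCommGroup Y] [NormedSpace 𝕜 Y]

/-- `P z` is a bijection for all parameters with `|z| ≥ R`, and `‖(P z)⁻¹‖ ≤ C |z| ^ k` there. -/
def HasResolventGrowth {K D E : Type*} [Norm K] [Norm D] [Norm E]
    (P : K → D → E) (k : ℕ) : Prop :=
  ∃ C R : ℝ, 0 < C ∧ 0 < R ∧ ∀ z : K, R ≤ ‖z‖ →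
    Function.Bijective (P z) ∧ ∀ u : D, ‖u‖ ≤ C * ‖z‖ ^ k * ‖P z u‖

/-- The pencil `P(z) = z A + B` on `D = D_A ∩ D_B`. -/
def pencil (A B : X →ₗ.[𝕜] Y) (z : 𝕜) (x : ↥(A.domain ⊓ B.domain)) : Y :=
  z • A ⟨x, x.2.1⟩ + B ⟨x, x.2.2⟩

/-- The complex extension of the pencil of two operators between real spaces: a vector `x + i y`
of the complexification is the pair `(x, y)`, and `z = a + i b` acts accordingly. Only the class of
equivalent norms of the complexification matters below, so the product norm is used. -/
def complexifiedPencil (A B : X →ₗ.[𝕜] Y) (z : ℂ)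
    (u : ↥(A.domain ⊓ B.domain) × ↥(A.domain ⊓ B.domain)) : Y × Y :=
  ((z.re : 𝕜) • A ⟨u.1, u.1.2.1⟩ - (z.im : 𝕜) • A ⟨u.2, u.2.2.1⟩ + B ⟨u.1, u.1.2.2⟩,
   (z.im : 𝕜) • A ⟨u.1, u.1.2.1⟩ + (z.re : 𝕜) • A ⟨u.2, u.2.2.1⟩ + B ⟨u.2, u.2.2.2⟩)

/-- All complex `z` of large modulus are regular points of the pencil and its resolvent satisfies
`‖R(z)‖ ≤ C |z| ^ k` there. For complex spaces (`RCLike.I ≠ 0` in `𝕜`) this concerns the pencil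
itself, for real spaces (`RCLike.I = 0` in `𝕜`) its complex extension. -/
def PencilGrowth (A B : X →ₗ.[𝕜] Y) (k : ℕ) : Prop :=
  ((RCLike.I : 𝕜) ≠ 0 → HasResolventGrowth (pencil A B) k) ∧
  ((RCLike.I : 𝕜) = 0 → HasResolventGrowth (complexifiedPencil A B) k)

/-- `λ A + B` is a regular pencil of index `ν`. For `ν ≥ 1`: `ν` is the least positive integer such
that `‖R(λ)‖ ≤ C |λ| ^ (ν - 1)` for all `λ` of large modulus (equivalently `∞` is a pole of the
resolvent of order `ν - 1`, a removable singularity being a pole of order `0`). For `ν = 0`: `A` has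
a bounded everywhere defined inverse and `D_A ⊆ D_B`. -/
def IsRegularPencilOfIndex (A B : X →ₗ.[𝕜] Y) : ℕ → Prop
  | 0 => A.domain ≤ B.domain ∧ Function.Bijective A ∧
      ∃ C : ℝ, ∀ x : A.domain, ‖(x : X)‖ ≤ C * ‖A x‖
  | k + 1 => IsLeast {j : ℕ | PencilGrowth A B j} k

/-- The restriction of `B` to `D = D_A`. -/
def onDomain (A B : X →ₗ.[𝕜] Y) (hAB : A.domain ≤ B.domain) : A.domain →ₗ[𝕜] Y :=
  B.toFun ∘ₗ Submodule.inclusion hAB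

/-- A canonical system `φ_i^j` (`1 ≤ i ≤ n`, `1 ≤ j ≤ m_i`) of eigenvectors and adjoined vectors of
the pencil `A + μ B` at `μ = 0`, with a corresponding system of bounded functionals `q_i^j`.
Values `φ i j`, `q i j` with `j = 0` or `j > m i` are never used. -/
structure RootSystem (A B : X →ₗ.[𝕜] Y) (hAB : A.domain ≤ B.domain) where
  /-- the dimension of `ker A` -/
  n : ℕ
  /-- the multiplicities of the eigenvectors -/
  m : Fin n → ℕ
  one_le_m : ∀ i, 1 ≤ m i
  /-- the root vectors -/
  φ : Fin n → ℕ → A.domain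
  /-- the functionals -/
  q : Fin n → ℕ → (Y →L[𝕜] 𝕜)
  linearIndependent_eigenvectors : LinearIndependent 𝕜 fun i => φ i 1
  span_eigenvectors : Submodule.span 𝕜 (Set.range fun i => φ i 1) = LinearMap.ker A.toFun
  /-- `A φ_i^j = - B φ_i^(j-1)` for `2 ≤ j ≤ m_i` -/
  chain : ∀ i j, 1 ≤ j → j + 1 ≤ m i → A (φ i (j + 1)) = - onDomain A B hAB (φ i j)
  /-- `A* q_i^(m_i) = 0` -/
  adjoint_last : ∀ i, ∀ x : A.domain, q i (m i) (A x) = 0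
  /-- `A* q_i^j = - B* q_i^(j+1)` for `1 ≤ j ≤ m_i - 1` -/
  adjoint_chain : ∀ i j, 1 ≤ j → j + 1 ≤ m i →
    ∀ x : A.domain, q i j (A x) = - q i (j + 1) (onDomain A B hAB x)
  /-- `⟨B φ_i^j, q_k^l⟩ = δ_ik δ_jl` -/
  biorthogonal : ∀ i j k l, 1 ≤ j → j ≤ m i → 1 ≤ l → l ≤ m k →
    q k l (onDomain A B hAB (φ i j)) = if i = k ∧ j = l then 1 else 0

end Pencil

namespace RootSystem

variable {𝕜 X Y : Type*} [RCLike 𝕜]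
  [NormedAddCommGroup X] [NormedSpace 𝕜 X] [NormedAddCommGroup Y] [NormedSpace 𝕜 Y]
  {A B : X →ₗ.[𝕜] Y} {hAB : A.domain ≤ B.domain} (S : RootSystem A B hAB)

/-- `B` as a linear map on `D = D_A`. -/
def Bop (_S : RootSystem A B hAB) : A.domain →ₗ[𝕜] Y := onDomain A B hAB

/-- `P_20 = ∑_i ⟨·, B* q_i^1⟩ φ_i^1`. -/
def P20 : A.domain →ₗ[𝕜] A.domain :=
  ∑ i, ((S.q i 1 : Y →ₗ[𝕜] 𝕜) ∘ₗ S.Bop).smulRight (S.φ i 1)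

/-- `P_2Σ = ∑_i ∑_{2 ≤ j ≤ m_i} ⟨·, B* q_i^j⟩ φ_i^j`. -/
def P2Sigma : A.domain →ₗ[𝕜] A.domain :=
  ∑ i, ∑ j ∈ Finset.Icc 2 (S.m i), ((S.q i j : Y →ₗ[𝕜] 𝕜) ∘ₗ S.Bop).smulRight (S.φ i j)

/-- `P_1 = I - P_2` with `P_2 = P_20 + P_2Σ`. -/
def P1 : A.domain →ₗ[𝕜] A.domain := LinearMap.id - (S.P20 + S.P2Sigma)

/-- `Q_2* = ∑_i ⟨·, q_i^(m_i)⟩ B φ_i^(m_i)`. -/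
def Q2star : Y →ₗ[𝕜] Y :=
  ∑ i, (S.q i (S.m i) : Y →ₗ[𝕜] 𝕜).smulRight (S.Bop (S.φ i (S.m i)))

/-- `Q_2Σ = ∑_i ∑_{1 ≤ j ≤ m_i - 1} ⟨·, q_i^j⟩ B φ_i^j`. -/
def Q2Sigma : Y →ₗ[𝕜] Y :=
  ∑ i, ∑ j ∈ Finset.Ico 1 (S.m i), (S.q i j : Y →ₗ[𝕜] 𝕜).smulRight (S.Bop (S.φ i j))

/-- `Q_1 = I - Q_2` with `Q_2 = Q_2Σ + Q_2*`. -/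
def Q1 : Y →ₗ[𝕜] Y := LinearMap.id - (S.Q2Sigma + S.Q2star)

/-- `D_1 = P_1 D`. -/
def D1 : Submodule 𝕜 A.domain := LinearMap.range S.P1

/-- `D_20 = ker A`. -/
def D20 (_S : RootSystem A B hAB) : Submodule 𝕜 A.domain := LinearMap.ker A.toFun

/-- `D_2Σ`, the span of all adjoined vectors. -/
def D2Sigma : Submodule 𝕜 A.domain :=
  Submodule.span 𝕜 {v | ∃ i j, 2 ≤ j ∧ j ≤ S.m i ∧ v = S.φ i j}

/-- `Y_1 = Q_1 Y`. -/
def Y1 : Submodule 𝕜 Y := LinearMap.range S.Q1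

/-- `Y_2* = span {B φ_i^(m_i)}`. -/
def Y2star : Submodule 𝕜 Y := Submodule.span 𝕜 (Set.range fun i => S.Bop (S.φ i (S.m i)))

/-- `Y_2Σ = span {B φ_i^j : 1 ≤ j ≤ m_i - 1}`. -/
def Y2Sigma : Submodule 𝕜 Y :=
  Submodule.span 𝕜 {v | ∃ i j, 1 ≤ j ∧ j < S.m i ∧ v = S.Bop (S.φ i j)}

/-- `W = Y_1 ∔ Y_2Σ`. -/
def W : Submodule 𝕜 Y := S.Y1 ⊔ S.Y2Sigma

/-- `Ã = A + ∑_i ⟨·, B* q_i^1⟩ B φ_i^(m_i)`. -/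
def Atilde : A.domain →ₗ[𝕜] Y :=
  A.toFun + ∑ i, ((S.q i 1 : Y →ₗ[𝕜] 𝕜) ∘ₗ S.Bop).smulRight (S.Bop (S.φ i (S.m i)))

/-- `M_{1,2Σ} = Ã⁻¹ M̃`. -/
def M12 (Mt : Set S.W) : Set A.domain := {x | ∃ w ∈ Mt, S.Atilde x = w}

/-- The direct sum `M_{1,2Σ} ∔ M_20`. -/
def Msum (Mt : Set S.W) (M20 : Set A.domain) : Set A.domain :=
  {x | ∃ a ∈ S.M12 Mt, ∃ b ∈ M20, x = a + b}

variable (f : ℝ → A.domain → Y)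

/-- `L_0 = {(t, x) ∈ ℝ₊ × D : Q_2* [f(t, x) - B x] = 0}`. -/
def L0 : Set (ℝ × A.domain) := {p | 0 ≤ p.1 ∧ S.Q2star (f p.1 p.2 - S.Bop p.2) = 0}

/-- `F_2*(t, x_1, x_2Σ, x_20) = Q_2* f(t, x) - Q_2* B (x_20 + x_2Σ)`, `x = x_1 + x_2Σ + x_20`. -/
def F2star (t : ℝ) (x1 x2S x20 : A.domain) : Y :=
  S.Q2star (f t (x1 + x2S + x20)) - S.Q2star (S.Bop (x20 + x2S))

/-- For all `t ≥ 0` and `x_1 + x_2Σ ∈ M_{1,2Σ}` there is a unique `x_20 ∈ M_20` with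
`(t, x_1 + x_2Σ + x_20) ∈ L_0`. -/
def UniquelySolvable (Mt : Set S.W) (M20 : Set A.domain) : Prop :=
  ∀ t : ℝ, 0 ≤ t → ∀ x ∈ S.M12 Mt, ∃! x20, x20 ∈ M20 ∧ (t, x + x20) ∈ S.L0 f

/-- The points of `L_0` with components in `M_{1,2Σ}` and `M_20` form a relatively open subset of
the points of `L_0` with `x_1 + x_2Σ ∈ M_{1,2Σ}`, for the norm `‖x_1‖ + ‖x_2Σ‖ + ‖x_20‖`.
This holds for every `M_20` that is open in `D_20`. -/
def RelativelyOpen (Mt : Set S.W) (M20 : Set A.domain) : Prop :=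
  ∀ t' : ℝ, ∀ x1' ∈ S.D1, ∀ x2S' ∈ S.D2Sigma, ∀ x20' ∈ M20,
    x1' + x2S' ∈ S.M12 Mt → (t', x1' + x2S' + x20') ∈ S.L0 f →
    ∃ r : ℝ, 0 < r ∧ ∀ t : ℝ, ∀ x1 ∈ S.D1, ∀ x2S ∈ S.D2Sigma, ∀ x20 ∈ S.D20,
      x1 + x2S ∈ S.M12 Mt → (t, x1 + x2S + x20) ∈ S.L0 f →
      |t - t'| < r → ‖x1 - x1'‖ < r → ‖x2S - x2S'‖ < r → ‖x20 - x20'‖ < r → x20 ∈ M20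

/-- The local contractivity condition on `F_2*` with respect to `x_20`. A common radius `δ` is used
for the neighbourhoods of `t'`, `x_1'`, `x_2Σ'`. The condition `lim q < ‖W⁻¹‖⁻¹` is written as
`(lim q) ‖W⁻¹‖ < 1`, so that it is satisfied when `D_20 = {0}`. -/
def LocallyContractive (Mt : Set S.W) (M20 : Set A.domain) : Prop :=
  ∀ t' : ℝ, ∀ x1' ∈ S.D1, ∀ x2S' ∈ S.D2Sigma, ∀ x20' ∈ M20,
    x1' + x2S' ∈ S.M12 Mt → (t', x1' + x2S' + x20') ∈ S.L0 f →
    ∃ (Wop : S.D20 ≃L[𝕜] S.Y2star) (q : ℝ → ℝ → ℝ) (l δ₀ ε₀ : ℝ),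
      0 < δ₀ ∧ 0 < ε₀ ∧
      Tendsto (fun p : ℝ × ℝ => q p.1 p.2) (𝓝[>] 0 ×ˢ 𝓝[>] 0) (𝓝 l) ∧
      l * ‖(Wop.symm : S.Y2star →L[𝕜] S.D20)‖ < 1 ∧
      ∀ δ ∈ Ioc 0 δ₀, ∀ ε ∈ Ioc 0 ε₀,
        ∀ t : ℝ, 0 ≤ t → |t - t'| < δ →
        ∀ x1 ∈ S.D1, ‖x1 - x1'‖ < δ → ∀ x2S ∈ S.D2Sigma, ‖x2S - x2S'‖ < δ →
        ∀ u v : S.D20, ‖(u : A.domain) - x20'‖ < ε → ‖(v : A.domain) - x20'‖ < ε →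
          ‖S.F2star f t x1 x2S u - S.F2star f t x1 x2S v - (Wop (u - v) : Y)‖
            ≤ q δ ε * ‖u - v‖

/-- The operator `∂_{x_20} F_2* = [∂_x (Q_2* f) - Q_2* B] : D_20 → Y_2*` is invertible at the points
of `L_0` with components in `M_{1,2Σ}` and `M_20`. -/
def DerivInvertible (Mt : Set S.W) (M20 : Set A.domain) : Prop :=
  ∀ t' : ℝ, ∀ x1' ∈ S.D1, ∀ x2S' ∈ S.D2Sigma, ∀ x20' ∈ M20,
    x1' + x2S' ∈ S.M12 Mt → (t', x1' + x2S' + x20') ∈ S.L0 f →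
    ∃ Wop : S.D20 ≃L[𝕜] S.Y2star, ∀ u : S.D20,
      (Wop u : Y) = S.Q2star (fderiv 𝕜 (f t') (x1' + x2S' + x20') u) - S.Q2star (S.Bop u)

end RootSystem

section Equation

/-- `f(t, x)` satisfies locally a Lipschitz condition with respect to `x` on `ℝ₊ × D`. -/
def LocallyLipschitzInX {D Y : Type*} [SeminormedAddCommGroup D] [SeminormedAddCommGroup Y]
    (f : ℝ → D → Y) : Prop :=
  ∀ t' : ℝ, 0 ≤ t' → ∀ x' : D, ∃ r L : ℝ, 0 < r ∧ 0 ≤ L ∧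
    ∀ t : ℝ, 0 ≤ t → |t - t'| < r → ∀ x₁ x₂ : D, ‖x₁ - x'‖ < r → ‖x₂ - x'‖ < r →
      ‖f t x₁ - f t x₂‖ ≤ L * ‖x₁ - x₂‖

/-- `f(t, x)` has a continuous (Fréchet) partial derivative with respect to `x` on `ℝ₊ × D`. -/
def HasContinuousPartial (𝕜 : Type*) {D Y : Type*} [RCLike 𝕜]
    [NormedAddCommGroup D] [NormedSpace 𝕜 D] [NormedAddCommGroup Y] [NormedSpace 𝕜 Y]
    (f : ℝ → D → Y) : Prop :=
  (∀ t : ℝ, 0 ≤ t → Differentiable 𝕜 (f t)) ∧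
  ContinuousOn (fun p : ℝ × D => fderiv 𝕜 (f p.1) p.2) (Ici 0 ×ˢ univ)

variable {𝕜 X Y : Type*} [RCLike 𝕜]
  [NormedAddCommGroup X] [NormedSpace 𝕜 X] [NormedAddCommGroup Y] [NormedSpace 𝕜 Y]
  [NormedSpace ℝ Y]

/-- `x` is a solution of `d/dt [A x] + B x = f(t, x)` on the interval `J`: `x ∈ C(J, X)` has its
values in `D`, `A x ∈ C¹(J, Y)` (one-sided derivatives at end points), and the equation holds
on `J`. -/
def IsSolutionOn (A B : X →ₗ.[𝕜] Y) (hAB : A.domain ≤ B.domain) (f : ℝ → A.domain → Y)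
    (J : Set ℝ) (x : ℝ → A.domain) : Prop :=
  ContinuousOn (fun t => (x t : X)) J ∧
  ∃ v : ℝ → Y, ContinuousOn v J ∧
    ∀ t ∈ J, HasDerivWithinAt (fun s => A (x s)) (v t) J t ∧
      v t + onDomain A B hAB (x t) = f t (x t)

/-- The initial value problem `d/dt [A x] + B x = f(t, x)`, `x(t₀) = x₀` has a unique solution in `M`
on the maximal interval of existence `[t₀, T)`, `T ≤ ∞`: there is a solution on `[t₀, T)` with
values in `M`, and each solution with values in `M` and the same initial value on any interval `J`
with left end point `t₀` satisfies `J ⊆ [t₀, T)` and coincides with it on `J`. -/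
def HasUniqueMaximalSolution (A B : X →ₗ.[𝕜] Y) (hAB : A.domain ≤ B.domain)
    (f : ℝ → A.domain → Y) (M : Set A.domain) (t₀ : ℝ) (x₀ : A.domain) : Prop :=
  ∃ (T : EReal) (x : ℝ → A.domain), (t₀ : EReal) < T ∧
    IsSolutionOn A B hAB f {t : ℝ | t₀ ≤ t ∧ (t : EReal) < T} x ∧ x t₀ = x₀ ∧
    (∀ t : ℝ, t₀ ≤ t → (t : EReal) < T → x t ∈ M) ∧
    ∀ (J : Set ℝ) (y : ℝ → A.domain), J.OrdConnected → t₀ ∈ J → J ⊆ Ici t₀ →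
      IsSolutionOn A B hAB f J y → y t₀ = x₀ → (∀ t ∈ J, y t ∈ M) →
      J ⊆ {t : ℝ | t₀ ≤ t ∧ (t : EReal) < T} ∧ EqOn y x J

end Equation

end ADAE

/-!
The equation `d/dt [A x] + B x = f(t, x)` splits into an ordinary differential equation for
`w = A x` and a constraint. Every solution satisfies the constraint `Q_2* [f(t, x) - B x] = 0`, because
`A x`, and hence its derivative, lies in the kernel `W` of `Q_2*`
(`RootSystem.mem_L0_of_isSolutionOn`). The operator `Ã` is a bijection of `D` onto `Y` with an
inverse `K` such that `K` and `B K` are bounded, and `x = K w + φ(t, w)`, where `K w = x_1 + x_2Σ`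
and where the component `φ(t, w)` in `ker A` is determined by the constraint. So `x` is a solution
if and only if `w` solves `w' = f(t, K w + φ(t, w)) - B (K w + φ(t, w))` in the Banach space `W`.

* The contraction principle shows that `φ` is continuous, and locally Lipschitz in `w`
  (`RootSystem.exists_implicit_function`). The local solution it yields lies in `M_20` by relative
  openness, so it agrees with the unique one there. The condition on the derivative of `f`
  implies the contractivity condition by the mean value inequality
  (`RootSystem.locallyContractive_of_derivInvertible`).
* The Picard–Lindelöf theorem and continuation of solutions give the maximal solution `w`
  (`exists_maximal_ode_solution`).

It remains to see that `Ã` is bijective and that root systems exist. Since `B` is bounded relative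
to `A`, for `ν ≥ 1` the companion operator `T = A (r A + B)⁻¹` is bounded on `Y` for a large real
`r`, and the growth condition on the resolvent of the pencil becomes a polynomial bound for
`(1 + μ T)⁻¹`, `μ → ∞`. This bound makes the kernels of `T ^ j` stationary from some `p` on
(`ker_pow_le_of_resolvent_bound`). Modulo the finite-dimensional space `N = ker (T ^ p)` the
operator `T` is injective with closed range, so it is bounded below, and solvability of
`y + μ T y = μ z` for `μ → ∞` makes it surjective (`range_sup_ker_pow_eq_top`). Hence
`Y = N ∔ range (T ^ p)`, and the codimension of the range of `A` equals `dim ker A`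
(`finrank_quotient_range_of_regular`), which yields the surjectivity of `Ã`. On `N` everything is
linear algebra: root vectors and functionals come from the Jordan chains of a nilpotent operator
(`exists_jordan_chains`, `nonempty_rootSystem`). For `ν = 0` the kernel of `A` is trivial and `A`
is onto.
-/

namespace ADAE

/-! ### Maximal solutions of ordinary differential equations -/

section ODE

variable {E : Type*} [NormedAddCommGroup E] [NormedSpace ℝ E]

/-- `w` solves `w' = g(t, w)` on `J` (one-sided derivatives at end points) with values in `U`. -/
def IsODESolutionOn (g : ℝ → E → E) (U : Set E) (J : Set ℝ) (w : ℝ → E) : Prop :=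
  ∀ t ∈ J, w t ∈ U ∧ HasDerivWithinAt w (g t (w t)) J t

/-- `g(t, w)` is locally Lipschitz in `w ∈ U`, locally uniformly in `t ≥ 0`. -/
def LocallyLipschitzInState (g : ℝ → E → E) (U : Set E) : Prop :=
  ∀ t' : ℝ, 0 ≤ t' → ∀ w' ∈ U, ∃ r L : ℝ, 0 < r ∧ 0 ≤ L ∧
    ∀ t : ℝ, 0 ≤ t → |t - t'| < r → ∀ w₁ ∈ U, ∀ w₂ ∈ U, ‖w₁ - w'‖ < r → ‖w₂ - w'‖ < r →
      ‖g t w₁ - g t w₂‖ ≤ L * ‖w₁ - w₂‖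

variable {g : ℝ → E → E} {U : Set E}

lemma IsODESolutionOn.mono {J J' : Set ℝ} {w : ℝ → E} (h : IsODESolutionOn g U J w)
    (hJ : J' ⊆ J) : IsODESolutionOn g U J' w :=
  fun t ht => ⟨(h t (hJ ht)).1, (h t (hJ ht)).2.mono hJ⟩

lemma IsODESolutionOn.continuousOn {J : Set ℝ} {w : ℝ → E} (h : IsODESolutionOn g U J w) :
    ContinuousOn w J :=
  fun t ht => (h t ht).2.continuousWithinAt

lemma IsODESolutionOn.congr {J : Set ℝ} {w y : ℝ → E} (h : IsODESolutionOn g U J w)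
    (hy : EqOn y w J) : IsODESolutionOn g U J y := fun t ht => by
  rw [hy ht]
  exact ⟨(h t ht).1, (h t ht).2.congr hy (hy ht)⟩

/-- Local existence to the right: the Picard–Lindelöf theorem, with the solution shrunk so that it
stays in the open set `U`. -/
lemma exists_local_solution [CompleteSpace E] (hU : IsOpen U)
    (hcont : ContinuousOn (fun p : ℝ × E => g p.1 p.2) (Ici 0 ×ˢ U))
    (hlip : LocallyLipschitzInState g U) {t' : ℝ} (ht' : 0 ≤ t') {w' : E} (hw' : w' ∈ U) :
    ∃ b > t', ∃ w : ℝ → E, w t' = w' ∧ IsODESolutionOn g U (Icc t' b) w := by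
  obtain ⟨r, L, hr, hL, hlip⟩ := hlip t' ht' w' hw'
  obtain ⟨ρ, hρ, hρU⟩ := Metric.isOpen_iff.1 hU w' hw'
  have hc := Metric.continuousOn_iff.1 hcont (t', w') ⟨ht', hw'⟩ 1 one_pos
  obtain ⟨η, hη, hc⟩ := hc
  set a : ℝ := min (min r ρ) η / 2 with ha
  have ha0 : 0 < a := by positivity
  have har : a < r := by
    have : min (min r ρ) η ≤ r := (min_le_left _ _).trans (min_le_left _ _)
    rw [ha]; linarith
  have haρ : a < ρ := by
    have : min (min r ρ) η ≤ ρ := (min_le_left _ _).trans (min_le_right _ _)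
    rw [ha]; linarith
  have haη : a < η := by
    have : min (min r ρ) η ≤ η := min_le_right _ _
    rw [ha]; linarith
  set M : ℝ := ‖g t' w'‖ + 1 with hM
  have hM1 : 1 ≤ M := by rw [hM]; linarith [norm_nonneg (g t' w')]
  set ε : ℝ := a / M with hε
  have hε0 : 0 < ε := by positivity
  have hεa : ε ≤ a := div_le_self ha0.le hM1
  have hball : ∀ x ∈ Metric.closedBall w' a, x ∈ U := fun x hx =>
    hρU (Metric.closedBall_subset_ball haρ hx)
  have hPL : IsPicardLindelof g (tmin := t') (tmax := t' + ε) ⟨t', by simp [hε0.le]⟩ w'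
      ⟨a, ha0.le⟩ 0 ⟨M, by linarith⟩ ⟨L, hL⟩ := by
    refine ⟨fun t ht => ?_, fun x hx => ?_, fun t ht x hx => ?_, ?_⟩
    · refine LipschitzOnWith.of_dist_le_mul fun x hx y hy => ?_
      rw [dist_eq_norm, dist_eq_norm]
      refine hlip t (ht'.trans ht.1) ?_ x (hball x hx) y (hball y hy) ?_ ?_
      · rw [abs_of_nonneg (by linarith [ht.1])]; linarith [ht.2]
      · rw [← dist_eq_norm]; exact lt_of_le_of_lt hx har
      · rw [← dist_eq_norm]; exact lt_of_le_of_lt hy har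
    · exact hcont.comp (f := fun t : ℝ => (t, x)) (by fun_prop)
        (fun t ht => ⟨ht'.trans ht.1, hball x hx⟩)
    · have h := hc (t, x) ⟨ht'.trans ht.1, hball x hx⟩ (by
        rw [Prod.dist_eq]
        refine max_lt ?_ (lt_of_le_of_lt hx haη)
        simp only [Real.dist_eq]
        rw [abs_of_nonneg (by linarith [ht.1])]; linarith [ht.2])
      rw [dist_eq_norm] at h
      change ‖g t x‖ ≤ M
      have h2 := norm_sub_norm_le (g t x) (g t' w')
      simp only at h
      rw [hM]; linarith
    · change M * max (t' + ε - t') (t' - t') ≤ a - 0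
      rw [add_sub_cancel_left, sub_self, max_eq_left hε0.le, hε, sub_zero]
      exact (mul_div_cancel₀ a (by linarith : M ≠ 0)).le
  obtain ⟨α, hα0, hα⟩ := hPL.exists_eq_forall_mem_Icc_hasDerivWithinAt₀
  simp only at hα0
  have hcα : ContinuousWithinAt α (Icc t' (t' + ε)) t' :=
    (hα t' (by simp [hε0.le])).continuousWithinAt
  have hev : ∀ᶠ t in 𝓝[≥] t', α t ∈ U := by
    have h1 : 𝓝[≥] t' = 𝓝[Icc t' (t' + ε)] t' :=
      (nhdsWithin_Icc_eq_nhdsGE (by linarith)).symm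
    rw [h1]
    exact hcα.eventually_mem (hU.mem_nhds (by rw [hα0]; exact hw'))
  obtain ⟨u, hu, huU⟩ := mem_nhdsGE_iff_exists_Icc_subset.1 hev
  refine ⟨min u (t' + ε), lt_min hu (by linarith), α, hα0, fun t ht => ⟨huU ?_, ?_⟩⟩
  · exact ⟨ht.1, ht.2.trans (min_le_left _ _)⟩
  · exact (hα t ⟨ht.1, ht.2.trans (min_le_right _ _)⟩).mono
      (Icc_subset_Icc_right (min_le_right _ _))

/-- Two solutions that agree at the left end point agree at the right end point: by continuous
induction, since solutions that agree at a time agree a little longer. -/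
lemma IsODESolutionOn.eq_of_eq_left (hlip : LocallyLipschitzInState g U) {a b : ℝ} (ha : 0 ≤ a)
    (hab : a ≤ b) {w y : ℝ → E} (hw : IsODESolutionOn g U (Icc a b) w)
    (hy : IsODESolutionOn g U (Icc a b) y) (h : w a = y a) : w b = y b := by
  have hcl : IsClosed ({t | w t = y t} ∩ Icc a b) := by
    have h1 : ContinuousOn (fun t => (w t, y t)) (Icc a b) := hw.continuousOn.prodMk hy.continuousOn
    have h2 := h1.preimage_isClosed_of_isClosed isClosed_Icc isClosed_diagonal
    rwa [inter_comm] at h2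
  refine hcl.mem_of_ge_of_forall_exists_gt h hab ?_
  rintro τ ⟨hτ, hτa, hτb⟩
  have hτ' : τ ∈ Icc a b := ⟨hτa, hτb.le⟩
  obtain ⟨r, L, hr, hL, hlip⟩ := hlip τ (ha.trans hτa) (w τ) (hw τ hτ').1
  have hnhds : 𝓝[Icc a b] τ ≥ 𝓝[≥] τ :=
    nhdsWithin_le_of_mem (Icc_mem_nhdsGE_of_mem ⟨hτa, hτb⟩)
  have hev : ∀ᶠ t in 𝓝[≥] τ, ‖w t - w τ‖ < r ∧ ‖y t - w τ‖ < r ∧ |t - τ| < r := by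
    have e1 : ∀ᶠ t in 𝓝[≥] τ, ‖w t - w τ‖ < r := by
      have := (hw.continuousOn τ hτ').mono_left hnhds
      filter_upwards [this (Metric.ball_mem_nhds _ hr)] with t ht
      rw [← dist_eq_norm]; exact ht
    have e2 : ∀ᶠ t in 𝓝[≥] τ, ‖y t - w τ‖ < r := by
      have := (hy.continuousOn τ hτ').mono_left hnhds
      rw [show w τ = y τ from hτ]
      filter_upwards [this (Metric.ball_mem_nhds _ hr)] with t ht
      rw [← dist_eq_norm]; exact ht
    have e3 : ∀ᶠ t in 𝓝[≥] τ, |t - τ| < r := by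
      refine mem_nhdsWithin_of_mem_nhds ?_
      filter_upwards [Metric.ball_mem_nhds τ hr] with t ht
      rwa [Metric.mem_ball, Real.dist_eq] at ht
    exact e1.and (e2.and e3)
  obtain ⟨c, hc, hcs⟩ := mem_nhdsGE_iff_exists_Icc_subset.1 hev
  set d := min c b with hd
  have hτd : τ < d := lt_min hc hτb
  have hsub : Icc τ d ⊆ Icc a b := Icc_subset_Icc hτa (min_le_right _ _)
  have hder : ∀ {z : ℝ → E}, IsODESolutionOn g U (Icc a b) z →
      ∀ t ∈ Ico τ d, HasDerivWithinAt z (g t (z t)) (Ici t) t := fun {z} hz t ht =>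
    (hz t (hsub (Ico_subset_Icc_self ht))).2.mono_of_mem_nhdsWithin
      (Icc_mem_nhdsGE_of_mem ⟨hτa.trans ht.1, ht.2.trans_le (min_le_right _ _)⟩)
  have hmem : ∀ t ∈ Ico τ d, t ∈ Icc τ c := fun t ht =>
    ⟨ht.1, ht.2.le.trans (min_le_left _ _)⟩
  have huniq : EqOn w y (Icc τ d) := by
    refine ODE_solution_unique_of_mem_Icc_right (v := g) (K := ⟨L, hL⟩)
      (s := fun _ => {u | u ∈ U ∧ ‖u - w τ‖ < r}) (fun t ht => ?_) (hw.continuousOn.mono hsub)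
      (hder hw) (fun t ht => ?_) (hy.continuousOn.mono hsub) (hder hy) (fun t ht => ?_) hτ
    · refine LipschitzOnWith.of_dist_le_mul fun u hu v hv => ?_
      rw [dist_eq_norm, dist_eq_norm]
      exact hlip t (ha.trans (hτa.trans ht.1)) (hcs (hmem t ht)).2.2 u hu.1 v hv.1 hu.2 hv.2
    · exact ⟨(hw t (hsub (Ico_subset_Icc_self ht))).1, (hcs (hmem t ht)).1⟩
    · exact ⟨(hy t (hsub (Ico_subset_Icc_self ht))).1, (hcs (hmem t ht)).2.1⟩
  exact ⟨d, huniq ⟨hτd.le, le_rfl⟩, hτd, min_le_right _ _⟩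

/-- Solutions on `[a, b]` and `[b, c]` that agree at `b` can be glued. -/
lemma IsODESolutionOn.glue {a b c : ℝ} (hab : a ≤ b) (hbc : b ≤ c) {w y : ℝ → E}
    (hw : IsODESolutionOn g U (Icc a b) w) (hy : IsODESolutionOn g U (Icc b c) y)
    (h : w b = y b) :
    IsODESolutionOn g U (Icc a c) (fun t => if t ≤ b then w t else y t) := by
  set z : ℝ → E := fun t => if t ≤ b then w t else y t with hz
  have hzw : EqOn z w (Icc a b) := fun t ht => if_pos ht.2
  have hzy : EqOn z y (Icc b c) := fun t ht => by
    rcases ht.1.eq_or_lt with rfl | hlt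
    · simp [hz, h]
    · exact if_neg (not_le.2 hlt)
  have hzw' := hw.congr hzw
  have hzy' := hy.congr hzy
  intro t ht
  rcases lt_trichotomy t b with hlt | rfl | hgt
  · have htab : t ∈ Icc a b := ⟨ht.1, hlt.le⟩
    refine ⟨(hzw' t htab).1, (hzw' t htab).2.mono_of_mem_nhdsWithin ?_⟩
    filter_upwards [self_mem_nhdsWithin, mem_nhdsWithin_of_mem_nhds (Iio_mem_nhds hlt)] with
      s hs hs'
    exact ⟨hs.1, le_of_lt hs'⟩
  · have h1 := hzw' t ⟨hab, le_rfl⟩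
    have h2 := hzy' t ⟨le_rfl, hbc⟩
    refine ⟨h1.1, ?_⟩
    rw [← Icc_union_Icc_eq_Icc hab hbc]
    exact h1.2.union h2.2
  · have htbc : t ∈ Icc b c := ⟨hgt.le, ht.2⟩
    refine ⟨(hzy' t htbc).1, (hzy' t htbc).2.mono_of_mem_nhdsWithin ?_⟩
    filter_upwards [self_mem_nhdsWithin, mem_nhdsWithin_of_mem_nhds (Ioi_mem_nhds hgt)] with
      s hs hs'
    exact ⟨le_of_lt hs', hs.2⟩

/-- The initial value problem `w' = g(t, w)`, `w(t₀) = w₀` has a maximal solution in `U` on an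
interval `[t₀, T)`, and every solution on an interval with left end point `t₀` is a restriction
of it. -/
theorem exists_maximal_ode_solution [CompleteSpace E] (hU : IsOpen U)
    (hcont : ContinuousOn (fun p : ℝ × E => g p.1 p.2) (Ici 0 ×ˢ U))
    (hlip : LocallyLipschitzInState g U) {t₀ : ℝ} (ht₀ : 0 ≤ t₀) {w₀ : E} (hw₀ : w₀ ∈ U) :
    ∃ (T : EReal) (w : ℝ → E), (t₀ : EReal) < T ∧
      IsODESolutionOn g U {t : ℝ | t₀ ≤ t ∧ (t : EReal) < T} w ∧ w t₀ = w₀ ∧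
      ∀ (J : Set ℝ) (y : ℝ → E), J.OrdConnected → t₀ ∈ J → J ⊆ Ici t₀ →
        IsODESolutionOn g U J y → y t₀ = w₀ →
        J ⊆ {t : ℝ | t₀ ≤ t ∧ (t : EReal) < T} ∧ EqOn y w J := by
  -- the times that are reached by solutions on compact intervals
  set R : Set ℝ := {τ | t₀ ≤ τ ∧ ∃ w : ℝ → E, w t₀ = w₀ ∧ IsODESolutionOn g U (Icc t₀ τ) w} with hR
  have hext : ∀ τ ∈ R, ∃ b ∈ R, τ < b := by
    rintro τ ⟨hτ, w, hw0, hw⟩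
    obtain ⟨b, hb, y, hyτ, hy⟩ :=
      exists_local_solution hU hcont hlip (ht₀.trans hτ) (hw τ ⟨hτ, le_rfl⟩).1
    exact ⟨b, ⟨hτ.trans hb.le, _, by simp [hτ, hw0], hw.glue hτ hb.le hy hyτ.symm⟩, hb⟩
  have hstart : ∃ b ∈ R, t₀ < b := by
    obtain ⟨b, hb, y, hy0, hy⟩ := exists_local_solution hU hcont hlip ht₀ hw₀
    exact ⟨b, ⟨hb.le, y, hy0, hy⟩, hb⟩
  have hdown : ∀ τ ∈ R, ∀ s, t₀ ≤ s → s ≤ τ → s ∈ R := by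
    rintro τ ⟨hτ, w, hw0, hw⟩ s hs hsτ
    exact ⟨hs, w, hw0, hw.mono (Icc_subset_Icc_right hsτ)⟩
  set T : EReal := sSup ((fun τ : ℝ => (τ : EReal)) '' R) with hT
  have hlt : ∀ t : ℝ, t₀ ≤ t → ((t : EReal) < T ↔ t ∈ R) := by
    intro t ht
    constructor
    · intro h
      obtain ⟨_, ⟨τ, hτ, rfl⟩, h⟩ := lt_sSup_iff.1 h
      exact hdown τ hτ t ht (EReal.coe_lt_coe_iff.1 h).le
    · intro h
      obtain ⟨b, hb, htb⟩ := hext t h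
      exact lt_sSup_iff.2 ⟨_, ⟨b, hb, rfl⟩, EReal.coe_lt_coe_iff.2 htb⟩
  choose! sol hsol0 hsol using fun τ (hτ : τ ∈ R) => hτ.2
  have hagree : ∀ τ ∈ R, ∀ y : ℝ → E, y t₀ = w₀ → IsODESolutionOn g U (Icc t₀ τ) y →
      y τ = sol τ τ := fun τ hτ y hy0 hy =>
    hy.eq_of_eq_left hlip ht₀ hτ.1 (hsol τ hτ) (hy0.trans (hsol0 τ hτ).symm)
  have hsolR : ∀ b ∈ R, EqOn (fun t => sol t t) (sol b) (Icc t₀ b) := fun b hb t ht =>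
    (hagree t (hdown b hb t ht.1 ht.2) (sol b) (hsol0 b hb)
      ((hsol b hb).mono (Icc_subset_Icc_right ht.2))).symm
  have hbegin : t₀ ∈ R := by
    obtain ⟨b, hb, h⟩ := hstart
    exact hdown b hb t₀ le_rfl h.le
  refine ⟨T, fun t => sol t t, (hlt t₀ le_rfl).2 hbegin, ?_, hsol0 t₀ hbegin, ?_⟩
  · rintro t ⟨ht, htT⟩
    obtain ⟨b, hb, htb⟩ := hext t ((hlt t ht).1 htT)
    have h := (hsol b hb).congr (hsolR b hb) t ⟨ht, htb.le⟩
    refine ⟨h.1, h.2.mono_of_mem_nhdsWithin ?_⟩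
    filter_upwards [self_mem_nhdsWithin, mem_nhdsWithin_of_mem_nhds (Iio_mem_nhds htb)] with
      s hs hs'
    exact ⟨hs.1, le_of_lt hs'⟩
  · intro J y hJ ht₀J hJge hy hy0
    have hIcc : ∀ t ∈ J, IsODESolutionOn g U (Icc t₀ t) y := fun t ht => hy.mono (hJ.out ht₀J ht)
    have hJR : ∀ t ∈ J, t ∈ R := fun t ht => ⟨hJge ht, y, hy0, hIcc t ht⟩
    exact ⟨fun t ht => ⟨hJge ht, (hlt t (hJge ht)).2 (hJR t ht)⟩,
      fun t ht => hagree t (hJR t ht) y hy0 (hIcc t ht)⟩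

end ODE

/-! ### Bounded operators whose resolvent grows polynomially at zero -/

section RieszDecomposition

variable {K V : Type*} [Field K] [AddCommGroup V] [Module K V] {T : V →ₗ[K] V} {p : ℕ}

lemma map_mem_ker_pow {y : V} (hy : y ∈ LinearMap.ker (T ^ p)) : T y ∈ LinearMap.ker (T ^ p) := by
  rw [LinearMap.mem_ker] at hy ⊢
  rw [← Module.End.mul_apply, ← pow_succ, pow_succ', Module.End.mul_apply, hy, map_zero]

lemma mem_ker_pow_of_map_mem (hker : LinearMap.ker (T ^ (p + 1)) ≤ LinearMap.ker (T ^ p)) {y : V}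
    (hy : T y ∈ LinearMap.ker (T ^ p)) : y ∈ LinearMap.ker (T ^ p) := by
  refine hker ?_
  rw [LinearMap.mem_ker] at hy ⊢
  rw [pow_succ, Module.End.mul_apply, hy]

lemma ker_pow_add_le (hker : LinearMap.ker (T ^ (p + 1)) ≤ LinearMap.ker (T ^ p)) (j : ℕ) {y : V}
    (hy : (T ^ j) y ∈ LinearMap.ker (T ^ p)) : y ∈ LinearMap.ker (T ^ p) := by
  induction j with
  | zero => simpa using hy
  | succ j ih =>
    refine ih (mem_ker_pow_of_map_mem hker ?_)
    rwa [← Module.End.mul_apply, ← pow_succ']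

lemma range_pow_sup_ker_pow (hsup : LinearMap.range T ⊔ LinearMap.ker (T ^ p) = ⊤) (j : ℕ) :
    LinearMap.range (T ^ j) ⊔ LinearMap.ker (T ^ p) = ⊤ := by
  induction j with
  | zero => simp [Module.End.one_eq_id]
  | succ j ih =>
    rw [eq_top_iff]
    rintro y -
    obtain ⟨_, ⟨z, rfl⟩, n, hn, rfl⟩ := Submodule.mem_sup.1 (hsup ▸ Submodule.mem_top : y ∈ _)
    obtain ⟨_, ⟨z', rfl⟩, n', hn', rfl⟩ := Submodule.mem_sup.1 (ih ▸ Submodule.mem_top : z ∈ _)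
    refine Submodule.mem_sup.2 ⟨_, ⟨z', rfl⟩, T n' + n, add_mem (map_mem_ker_pow hn') hn, ?_⟩
    rw [map_add, pow_succ', Module.End.mul_apply, add_assoc]

lemma isCompl_ker_pow_range_pow (hker : LinearMap.ker (T ^ (p + 1)) ≤ LinearMap.ker (T ^ p))
    (hsup : LinearMap.range T ⊔ LinearMap.ker (T ^ p) = ⊤) :
    IsCompl (LinearMap.ker (T ^ p)) (LinearMap.range (T ^ p)) := by
  refine ⟨Submodule.disjoint_def.2 ?_, codisjoint_iff.2 ?_⟩
  · rintro _ hy ⟨z, rfl⟩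
    exact ker_pow_add_le hker p hy
  · rw [sup_comm]; exact range_pow_sup_ker_pow hsup p

/-- `T` has Fredholm index zero: on the finite-dimensional part `ker (T ^ p)` the rank-nullity
theorem applies, and `T` is bijective on the complementary part. -/
lemma finrank_quotient_range (hp : 1 ≤ p)
    (hker : LinearMap.ker (T ^ (p + 1)) ≤ LinearMap.ker (T ^ p))
    (hsup : LinearMap.range T ⊔ LinearMap.ker (T ^ p) = ⊤)
    [FiniteDimensional K (LinearMap.ker (T ^ p))] :
    FiniteDimensional K (V ⧸ LinearMap.range T) ∧
      Module.finrank K (V ⧸ LinearMap.range T) = Module.finrank K (LinearMap.ker T) := by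
  set N := LinearMap.ker (T ^ p) with hN
  have hle : LinearMap.ker T ≤ N := by
    intro y hy
    rw [LinearMap.mem_ker] at hy
    obtain ⟨q, rfl⟩ : ∃ q, p = q + 1 := ⟨p - 1, by omega⟩
    rw [hN, LinearMap.mem_ker, pow_succ, Module.End.mul_apply, hy, map_zero]
  let π : N →ₗ[K] V ⧸ LinearMap.range T := (LinearMap.range T).mkQ ∘ₗ N.subtype
  let TN : N →ₗ[K] N := T.restrict fun y hy => map_mem_ker_pow hy
  have hπ : Function.Surjective π := by
    intro z
    obtain ⟨y, rfl⟩ := Submodule.mkQ_surjective _ z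
    obtain ⟨_, ⟨x, rfl⟩, n, hn, rfl⟩ := Submodule.mem_sup.1 (hsup ▸ Submodule.mem_top : y ∈ _)
    refine ⟨⟨n, hn⟩, ?_⟩
    change (LinearMap.range T).mkQ n = _
    have : (LinearMap.range T).mkQ (T x) = 0 := by simp
    rw [map_add, this, zero_add]
  have hkerπ : LinearMap.ker π = LinearMap.range TN := by
    ext ⟨n, hn⟩
    simp only [π, TN, LinearMap.mem_ker, LinearMap.comp_apply, Submodule.mkQ_apply,
      Submodule.Quotient.mk_eq_zero, LinearMap.mem_range, Submodule.subtype_apply]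
    constructor
    · rintro ⟨x, hx⟩
      exact ⟨⟨x, mem_ker_pow_of_map_mem hker (hx ▸ hn)⟩, Subtype.ext hx⟩
    · rintro ⟨x, hx⟩
      exact ⟨x, congrArg Subtype.val hx⟩
  have hfin : FiniteDimensional K (V ⧸ LinearMap.range T) := Module.Finite.of_surjective π hπ
  refine ⟨hfin, ?_⟩
  have h1 := LinearMap.finrank_range_add_finrank_ker π
  have h2 := LinearMap.finrank_range_add_finrank_ker TN
  rw [LinearMap.range_eq_top.2 hπ, finrank_top, hkerπ] at h1
  have h3 : Module.finrank K (LinearMap.ker TN) = Module.finrank K (LinearMap.ker T) := by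
    have : LinearMap.ker TN = Submodule.comap N.subtype (LinearMap.ker T) := by
      ext ⟨n, hn⟩
      simp only [TN, LinearMap.mem_ker, Submodule.mem_comap, Submodule.subtype_apply]
      exact Subtype.ext_iff
    rw [this]
    exact (Submodule.comapSubtypeEquivOfLe hle).finrank_eq
  omega

lemma finiteDimensional_ker_pow [FiniteDimensional K (LinearMap.ker T)] (j : ℕ) :
    FiniteDimensional K (LinearMap.ker (T ^ j)) := by
  induction j with
  | zero =>
    rw [pow_zero, Module.End.one_eq_id, LinearMap.ker_id]
    infer_instance
  | succ j ih =>
    let S : LinearMap.ker (T ^ (j + 1)) →ₗ[K] LinearMap.ker (T ^ j) :=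
      T.restrict fun y hy => by
        rw [LinearMap.mem_ker] at hy ⊢
        rwa [pow_succ, Module.End.mul_apply] at hy
    have hS : FiniteDimensional K (LinearMap.ker S) := by
      let ι : LinearMap.ker S →ₗ[K] LinearMap.ker T :=
        ((LinearMap.ker (T ^ (j + 1))).subtype ∘ₗ (LinearMap.ker S).subtype).codRestrict _
          fun y => by
          have := y.2
          rw [LinearMap.mem_ker] at this ⊢
          exact congrArg Subtype.val this
      refine FiniteDimensional.of_injective ι fun x y h => ?_
      have := congrArg Subtype.val h
      exact Subtype.ext (Subtype.ext this)
    have hr : FiniteDimensional K (LinearMap.range S) := inferInstance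
    have e := S.quotKerEquivRange
    have : FiniteDimensional K (LinearMap.ker (T ^ (j + 1)) ⧸ LinearMap.ker S) :=
      e.symm.finiteDimensional
    exact Module.Finite.of_submodule_quotient (LinearMap.ker S)

end RieszDecomposition

section Resolvent

variable {𝕜 Y : Type*} [RCLike 𝕜] [NormedAddCommGroup Y] [NormedSpace 𝕜 Y]

/-- A resolvent bound of order `k` stops the growth of the kernels of the powers: for
`T ^ (k + 2) y = 0` the resolvent at `y` is a polynomial in `μ` with top coefficient
`± T ^ (k + 1) y`. -/
lemma ker_pow_le_of_resolvent_bound (T : Y →L[𝕜] Y) {C : ℝ} {k : ℕ}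
    (h : ∀ μ : ℝ, 0 ≤ μ → ∀ y, ‖y‖ ≤ C * (1 + μ) ^ k * ‖y + (μ : 𝕜) • T y‖) {y : Y}
    (hy : (T ^ (k + 2)) y = 0) : (T ^ (k + 1)) y = 0 := by
  set M : ℝ := |C| * ‖y‖ + ∑ i ∈ Finset.range (k + 1), ‖(T ^ i) y‖ with hM
  have hM0 : 0 ≤ M := by positivity
  have key : ∀ μ : ℝ, 1 ≤ μ → μ * ‖(T ^ (k + 1)) y‖ ≤ M * 2 ^ k := by
    intro μ hμ
    have hμ0 : 0 < μ := by linarith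
    set x : Y →L[𝕜] Y := (-(μ : 𝕜)) • T with hx
    have hxi : ∀ i, (x ^ i) y = (-(μ : 𝕜)) ^ i • (T ^ i) y := fun i => by
      rw [hx, smul_pow, smul_apply]
    have hnx : ∀ i, ‖(x ^ i) y‖ = μ ^ i * ‖(T ^ i) y‖ := fun i => by
      rw [hxi, norm_smul, norm_pow, norm_neg, RCLike.norm_ofReal, abs_of_pos hμ0]
    set z : Y := ∑ i ∈ Finset.range (k + 2), (x ^ i) y with hz
    have hres : z + (μ : 𝕜) • T z = y := by
      have hz' : (∑ i ∈ Finset.range (k + 2), x ^ i) y = z := by rw [hz, sum_apply]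
      have h1 := congrArg (fun S : Y →L[𝕜] Y => S y) (mul_neg_geom_sum x (k + 2))
      change (∑ i ∈ Finset.range (k + 2), x ^ i) y - x ((∑ i ∈ Finset.range (k + 2), x ^ i) y)
        = y - (x ^ (k + 2)) y at h1
      rw [hz', hxi, hy, smul_zero, sub_zero, hx, smul_apply, neg_smul, sub_neg_eq_add] at h1
      exact h1
    have hb := h μ hμ0.le z
    rw [hres] at hb
    have htop : (x ^ (k + 1)) y = z - ∑ i ∈ Finset.range (k + 1), (x ^ i) y := by
      rw [hz, Finset.sum_range_succ _ (k + 1)]; abel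
    have h1 : μ ^ (k + 1) * ‖(T ^ (k + 1)) y‖ ≤ M * (1 + μ) ^ k := by
      rw [← hnx, htop]
      refine (norm_sub_le _ _).trans ?_
      rw [hM, add_mul]
      refine add_le_add ?_ ?_
      · calc ‖z‖ ≤ C * (1 + μ) ^ k * ‖y‖ := hb
          _ ≤ |C| * (1 + μ) ^ k * ‖y‖ := by gcongr; exact le_abs_self C
          _ = _ := by ring
      · refine (norm_sum_le _ _).trans ?_
        rw [Finset.sum_mul]
        refine Finset.sum_le_sum fun i hi => ?_
        rw [hnx, mul_comm]
        gcongr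
        calc μ ^ i ≤ (1 + μ) ^ i := by gcongr; linarith
          _ ≤ (1 + μ) ^ k := by
            gcongr
            · linarith
            · have := Finset.mem_range.1 hi; omega
    have h2 : M * (1 + μ) ^ k ≤ M * (2 ^ k * μ ^ k) := by
      rw [← mul_pow]
      gcongr
      linarith
    have h3 : μ ^ k * (μ * ‖(T ^ (k + 1)) y‖) ≤ μ ^ k * (M * 2 ^ k) := by
      calc _ = μ ^ (k + 1) * ‖(T ^ (k + 1)) y‖ := by ring
        _ ≤ _ := h1.trans h2
        _ = _ := by ring
    exact le_of_mul_le_mul_left h3 (by positivity)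
  by_contra hne
  have hpos : 0 < ‖(T ^ (k + 1)) y‖ := norm_pos_iff.2 hne
  have h1 := key (M * 2 ^ k / ‖(T ^ (k + 1)) y‖ + 1) (by
    have : 0 ≤ M * 2 ^ k / ‖(T ^ (k + 1)) y‖ := by positivity
    linarith)
  rw [add_mul, div_mul_cancel₀ _ hpos.ne'] at h1
  linarith

/-- An injective operator with closed range is bounded below, so the equations
`y + μ S y = μ z` give almost solutions of `S y = z` as `μ → ∞`. -/
lemma surjective_of_resolvent_surjective [CompleteSpace Y] (S : Y →L[𝕜] Y)
    (hinj : Function.Injective S) (hcl : IsClosed (range S))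
    (hs : ∀ μ : ℝ, 0 ≤ μ → Function.Surjective fun y => y + (μ : 𝕜) • S y) :
    Function.Surjective S := by
  obtain ⟨c, hc⟩ := S.antilipschitz_of_injective_of_isClosed_range hinj hcl
  have hb : ∀ y, ‖y‖ ≤ c * ‖S y‖ := fun y => by simpa using hc.le_mul_dist y 0
  intro z
  have hmem : z ∈ closure (range S) := by
    rw [Metric.mem_closure_iff]
    intro ε hε
    set μ : ℝ := 2 * c + 1 + 2 * c * ‖z‖ / ε with hμ
    have hc0 : (0 : ℝ) ≤ c := c.2
    have hq : 0 ≤ 2 * c * ‖z‖ / ε := by positivity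
    have hμ0 : 0 < μ := by rw [hμ]; linarith
    have hμ𝕜 : (μ : 𝕜) ≠ 0 := by exact_mod_cast hμ0.ne'
    obtain ⟨y, hy⟩ := hs μ hμ0.le ((μ : 𝕜) • z)
    simp only at hy
    have hSy : z - S y = (μ : 𝕜)⁻¹ • y := by
      have : y = (μ : 𝕜) • (z - S y) := by rw [smul_sub, ← hy]; abel
      nth_rewrite 2 [this]
      rw [inv_smul_smul₀ hμ𝕜]
    have hn : ‖z - S y‖ = μ⁻¹ * ‖y‖ := by
      rw [hSy, norm_smul, norm_inv, RCLike.norm_ofReal, abs_of_pos hμ0]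
    have h1 : ‖S y‖ ≤ ‖z‖ + μ⁻¹ * ‖y‖ := by
      rw [← hn]
      calc ‖S y‖ = ‖z - (z - S y)‖ := by congr 1; abel
        _ ≤ _ := norm_sub_le _ _
    have h2 : ‖y‖ ≤ 2 * c * ‖z‖ := by
      have h3 : ‖y‖ ≤ c * ‖z‖ + c * (μ⁻¹ * ‖y‖) := by
        calc ‖y‖ ≤ c * ‖S y‖ := hb y
          _ ≤ c * (‖z‖ + μ⁻¹ * ‖y‖) := by gcongr
          _ = _ := by ring
      have h4 : c * μ⁻¹ ≤ 1 / 2 := by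
        rw [← div_eq_mul_inv, div_le_div_iff₀ hμ0 two_pos, hμ]; linarith
      have h5 : c * (μ⁻¹ * ‖y‖) ≤ 1 / 2 * ‖y‖ := by
        rw [← mul_assoc]; gcongr
      linarith
    refine ⟨S y, ⟨y, rfl⟩, ?_⟩
    rw [dist_eq_norm, hn, inv_mul_lt_iff₀ hμ0]
    have h6 : μ * ε = (2 * c + 1) * ε + 2 * c * ‖z‖ := by
      rw [hμ, add_mul, div_mul_cancel₀ _ hε.ne']
    have : 0 < (2 * (c : ℝ) + 1) * ε := by positivity
    linarith
  rwa [hcl.closure_eq] at hmem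

/-- The range of `T` and the generalized kernel span the space: modulo the generalized kernel `T`
is injective with closed range. -/
lemma range_sup_ker_pow_eq_top [CompleteSpace Y] (T : Y →L[𝕜] Y) {p : ℕ}
    (hker : LinearMap.ker ((T : Y →ₗ[𝕜] Y) ^ (p + 1)) ≤ LinearMap.ker ((T : Y →ₗ[𝕜] Y) ^ p))
    [FiniteDimensional 𝕜 (LinearMap.ker ((T : Y →ₗ[𝕜] Y) ^ p))]
    (hcl : IsClosed (LinearMap.range (T : Y →ₗ[𝕜] Y) : Set Y))
    (hs : ∀ μ : ℝ, 0 ≤ μ → Function.Surjective fun y => y + (μ : 𝕜) • T y) :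
    LinearMap.range (T : Y →ₗ[𝕜] Y) ⊔ LinearMap.ker ((T : Y →ₗ[𝕜] Y) ^ p) = ⊤ := by
  set N := LinearMap.ker ((T : Y →ₗ[𝕜] Y) ^ p) with hN
  have hNcl : IsClosed (N : Set Y) := N.closed_of_finiteDimensional
  let S₀ : (Y ⧸ N) →ₗ[𝕜] Y ⧸ N := N.mapQ N (T : Y →ₗ[𝕜] Y) fun y hy => map_mem_ker_pow hy
  have hS₀ : Continuous S₀ := by
    refine (isQuotientMap_quot_mk.continuous_iff).2 ?_
    exact (continuous_quot_mk.comp T.continuous :)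
  let S : (Y ⧸ N) →L[𝕜] Y ⧸ N := ⟨S₀, hS₀⟩
  have hSmk : ∀ y, S (N.mkQ y) = N.mkQ (T y) := fun y => rfl
  have hinj : Function.Injective S := by
    refine (injective_iff_map_eq_zero S).2 fun z hz => ?_
    obtain ⟨y, rfl⟩ := N.mkQ_surjective z
    rw [hSmk, Submodule.mkQ_apply, Submodule.Quotient.mk_eq_zero] at hz
    rw [Submodule.mkQ_apply, Submodule.Quotient.mk_eq_zero]
    exact mem_ker_pow_of_map_mem hker hz
  have hrange : N.mkQ ⁻¹' (range S) =
      ((LinearMap.range (T : Y →ₗ[𝕜] Y) ⊔ N : Submodule 𝕜 Y) : Set Y) := by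
    ext y
    simp only [mem_preimage, mem_range, SetLike.mem_coe, Submodule.mem_sup]
    constructor
    · rintro ⟨z, hz⟩
      obtain ⟨x, rfl⟩ := N.mkQ_surjective z
      rw [hSmk, Submodule.mkQ_apply, Submodule.mkQ_apply, eq_comm, Submodule.Quotient.eq] at hz
      exact ⟨T x, ⟨x, rfl⟩, _, hz, by abel⟩
    · rintro ⟨_, ⟨x, rfl⟩, n, hn, rfl⟩
      refine ⟨N.mkQ x, ?_⟩
      rw [hSmk, map_add, Submodule.mkQ_apply N n, (Submodule.Quotient.mk_eq_zero N).2 hn, add_zero]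
      rfl
  have hSr : IsClosed (range S) := by
    refine (isQuotientMap_quot_mk.isClosed_preimage).1 ?_
    change IsClosed (N.mkQ ⁻¹' (range S))
    rw [hrange]
    exact Submodule.isClosed_sup_finiteDimensional _ _ hcl
  have hsurj := surjective_of_resolvent_surjective S hinj hSr fun μ hμ z => by
    obtain ⟨y, rfl⟩ := N.mkQ_surjective z
    obtain ⟨x, hx⟩ := hs μ hμ y
    refine ⟨N.mkQ x, ?_⟩
    simp only at hx ⊢
    rw [hSmk, ← map_smul, ← map_add, hx]
  rw [eq_top_iff]
  rintro y -
  change y ∈ ((LinearMap.range (T : Y →ₗ[𝕜] Y) ⊔ N : Submodule 𝕜 Y) : Set Y)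
  rw [← hrange]
  exact hsurj _

/-- A functional that vanishes on the range of a bounded operator whose range has a
finite-dimensional complement is bounded, by the open mapping theorem. -/
lemma continuous_of_vanishes_on_range [CompleteSpace Y] (R : Y →L[𝕜] Y) (N : Submodule 𝕜 Y)
    [FiniteDimensional 𝕜 N] (hsup : LinearMap.range (R : Y →ₗ[𝕜] Y) ⊔ N = ⊤) (l : Y →ₗ[𝕜] 𝕜)
    (hl : ∀ y, l (R y) = 0) : Continuous l := by
  let G : (Y × N) →L[𝕜] Y := R.coprod N.subtypeL
  have hG : Function.Surjective G := by
    intro y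
    obtain ⟨_, ⟨x, rfl⟩, n, hn, rfl⟩ := Submodule.mem_sup.1 (hsup ▸ Submodule.mem_top : y ∈ _)
    exact ⟨(x, ⟨n, hn⟩), by simp [G]⟩
  have hcomp : (l : Y → 𝕜) ∘ G = fun z => (l ∘ₗ N.subtype) z.2 := by
    funext z
    simp [G, hl]
  have : CompleteSpace N := FiniteDimensional.complete 𝕜 N
  refine ((G.isQuotientMap hG).continuous_iff).2 ?_
  rw [hcomp]
  exact (LinearMap.continuous_of_finiteDimensional _).comp continuous_snd

end Resolvent

/-! ### Jordan chains of a nilpotent endomorphism -/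

section Jordan

open Polynomial

variable {K : Type*} [Field K]

/-- The coefficient of `X ^ r`, `r < k`, is well defined modulo `X ^ k`. -/
lemma exists_coeff_quotient (k r : ℕ) (hr : r < k) :
    ∃ c : (K[X] ⧸ Submodule.span K[X] {(X : K[X]) ^ k}) →ₗ[K] K,
      ∀ g : K[X], c (Submodule.Quotient.mk g) = g.coeff r := by
  refine ⟨((Submodule.span K[X] {(X : K[X]) ^ k}).restrictScalars K).liftQ (lcoeff K r) ?_,
    fun g => rfl⟩
  intro g hg
  rw [Submodule.restrictScalars_mem, Submodule.mem_span_singleton] at hg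
  obtain ⟨a, rfl⟩ := hg
  rw [LinearMap.mem_ker, lcoeff_apply, smul_eq_mul, coeff_mul_X_pow', if_neg (by omega)]

/-- The kernel of the multiplication with `X` modulo `X ^ (r + 1)` is spanned by `X ^ r`. -/
lemma eq_smul_of_X_smul_eq_zero (r : ℕ)
    (y : K[X] ⧸ Submodule.span K[X] {(X : K[X]) ^ (r + 1)}) (hy : (X : K[X]) • y = 0) :
    ∃ c : K, y = c • Submodule.Quotient.mk (X ^ r) := by
  obtain ⟨g, rfl⟩ := Submodule.Quotient.mk_surjective _ y
  rw [← Submodule.Quotient.mk_smul, Submodule.Quotient.mk_eq_zero,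
    Submodule.mem_span_singleton] at hy
  obtain ⟨a, ha⟩ := hy
  rw [smul_eq_mul, smul_eq_mul, pow_succ, ← mul_assoc, mul_comm X g] at ha
  have hg : g = a * X ^ r := (mul_right_cancel₀ X_ne_zero ha).symm
  refine ⟨a.coeff 0, ?_⟩
  rw [← Submodule.Quotient.mk_smul, Submodule.Quotient.eq, Submodule.mem_span_singleton]
  refine ⟨a.divX, ?_⟩
  conv_rhs => rw [hg, ← a.divX_mul_X_add]
  simp only [smul_eq_mul, coeff_add, mul_coeff_zero, coeff_X_zero, mul_zero, coeff_C_zero, zero_add,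
    smul_eq_C_mul]
  ring

/-- A nilpotent endomorphism `S` of a finite-dimensional space has Jordan chains `e i j`,
`1 ≤ j ≤ m i`, together with dual chains of functionals. In the decomposition of the space into
modules `K[X] ⧸ (X ^ m)`, on which `S` acts as multiplication with `X`, the vectors are
`X ^ (m - j)` and the functionals are the coefficients at these powers. -/
theorem exists_jordan_chains {N : Type*} [AddCommGroup N] [Module K N] [FiniteDimensional K N]
    (S : N →ₗ[K] N) (hS : IsNilpotent S) :
    ∃ (n : ℕ) (m : Fin n → ℕ) (e : Fin n → ℕ → N) (q : Fin n → ℕ → (N →ₗ[K] K)),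
      (∀ i, 1 ≤ m i) ∧ (∀ i, S (e i 1) = 0) ∧
      (∀ i j, 1 ≤ j → j + 1 ≤ m i → S (e i (j + 1)) = e i j) ∧
      (∀ i x, q i (m i) (S x) = 0) ∧
      (∀ i j, 1 ≤ j → j + 1 ≤ m i → ∀ x, q i j (S x) = q i (j + 1) x) ∧
      (∀ i j k l, 1 ≤ j → j ≤ m i → 1 ≤ l → l ≤ m k →
        q k l (e i j) = if i = k ∧ j = l then 1 else 0) ∧
      LinearMap.ker S ≤ Submodule.span K (range fun i => e i 1) := by
  classical
  have htors : Module.IsTorsion' (Module.AEval' S) (Submonoid.powers (X : K[X])) := by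
    intro x
    obtain ⟨x, rfl⟩ := (Module.AEval'.of S).surjective x
    obtain ⟨r, hr⟩ := hS
    refine ⟨⟨X ^ r, r, rfl⟩, ?_⟩
    change (X ^ r : K[X]) • Module.AEval'.of S x = 0
    rw [Module.AEval'.X_pow_smul_of, hr, zero_smul, map_zero]
  obtain ⟨d, k, ⟨L⟩⟩ := Module.torsion_by_prime_power_decomposition (Polynomial.irreducible_X) htors
  choose! c hc using fun k r hr => exists_coeff_quotient (K := K) k r hr
  -- the coordinates of a vector in the summands
  let co : ∀ i, N →ₗ[K] K[X] ⧸ Submodule.span K[X] {(X : K[X]) ^ k i} := fun i =>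
    (DirectSum.component K[X] (Fin d) _ i).restrictScalars K ∘ₗ
      (L.toLinearMap.restrictScalars K) ∘ₗ (Module.AEval'.of S).toLinearMap
  let ve : ∀ i, K[X] → N := fun i g => (Module.AEval'.of S).symm (L.symm
    (DirectSum.lof K[X] (Fin d) (fun i => K[X] ⧸ Submodule.span K[X] {(X : K[X]) ^ k i}) i
      (Submodule.Quotient.mk g)))
  have hcoS : ∀ i x, co i (S x) = (X : K[X]) • co i x := by
    intro i x
    simp only [co, LinearMap.comp_apply, LinearMap.coe_restrictScalars, LinearEquiv.coe_coe]
    rw [← Module.AEval'.X_smul_of, map_smul, map_smul]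
  have hcoS' : ∀ i x g, co i x = Submodule.Quotient.mk g →
      co i (S x) = Submodule.Quotient.mk (X * g) := fun i x g h => by
    rw [hcoS, h, ← Submodule.Quotient.mk_smul, smul_eq_mul]
  have hSve : ∀ i g, S (ve i g) = ve i (X * g) := by
    intro i g
    simp only [ve]
    rw [← Module.AEval'.of_symm_X_smul, ← map_smul, ← map_smul, ← Submodule.Quotient.mk_smul,
      smul_eq_mul]
  have hcove : ∀ i g, co i (ve i g) = Submodule.Quotient.mk g := by
    intro i g
    simp only [co, ve, LinearMap.comp_apply, LinearMap.coe_restrictScalars, LinearEquiv.coe_coe,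
      LinearEquiv.apply_symm_apply, DirectSum.component.lof_self]
  have hcove' : ∀ i i' g, i ≠ i' → co i' (ve i g) = 0 := by
    intro i i' g h
    simp only [co, ve, LinearMap.comp_apply, LinearMap.coe_restrictScalars, LinearEquiv.coe_coe,
      LinearEquiv.apply_symm_apply]
    rw [DirectSum.component.of, dif_neg h]
  have hve0 : ∀ i g, X ^ k i ∣ g → ve i g = 0 := by
    intro i g h
    have : (Submodule.Quotient.mk g : K[X] ⧸ Submodule.span K[X] {(X : K[X]) ^ k i}) = 0 := by
      rw [Submodule.Quotient.mk_eq_zero]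
      exact Ideal.mem_span_singleton.2 h
    simp only [ve, this, map_zero]
  -- trivial summands are discarded
  let ι := {i : Fin d // k i ≠ 0}
  let eqv : Fin (Fintype.card ι) ≃ ι := (Fintype.equivFin ι).symm
  have hk : ∀ a, 1 ≤ k (eqv a) := fun a => Nat.one_le_iff_ne_zero.2 (eqv a).2
  refine ⟨Fintype.card ι, fun a => k (eqv a), fun a j => ve (eqv a) (X ^ (k (eqv a) - j)),
    fun a j => c (k (eqv a)) (k (eqv a) - j) ∘ₗ co (eqv a), hk, ?_, ?_, ?_, ?_, ?_, ?_⟩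
  · intro a
    rw [hSve, ← pow_succ', Nat.sub_add_cancel (hk a)]
    exact hve0 _ _ dvd_rfl
  · intro a j hj hjm
    simp only at hjm ⊢
    rw [hSve, ← pow_succ']
    congr 2
    omega
  · intro a x
    obtain ⟨g, hg⟩ := Submodule.Quotient.mk_surjective _ (co (eqv a) x)
    have := hk a
    change c (k (eqv a)) (k (eqv a) - k (eqv a)) (co (eqv a) (S x)) = 0
    rw [hcoS' _ _ g hg.symm, hc _ _ (by omega), Nat.sub_self, mul_coeff_zero,
      coeff_X_zero, zero_mul]
  · intro a j hj hjm x
    simp only at hjm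
    obtain ⟨g, hg⟩ := Submodule.Quotient.mk_surjective _ (co (eqv a) x)
    change c (k (eqv a)) (k (eqv a) - j) (co (eqv a) (S x)) =
      c (k (eqv a)) (k (eqv a) - (j + 1)) (co (eqv a) x)
    rw [hcoS' _ _ g hg.symm, hc _ _ (by omega), ← hg,
      hc _ _ (by omega), show k (eqv a) - j = (k (eqv a) - (j + 1)) + 1 by omega, coeff_X_mul]
  · intro a j b l hj hjm hl hlm
    simp only at hjm hlm
    rw [LinearMap.comp_apply]
    by_cases hab : a = b
    · subst hab
      rw [hcove, hc _ _ (by omega), coeff_X_pow]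
      congr 1
      simp only [true_and, eq_iff_iff]
      omega
    · rw [hcove' _ _ _ (fun h => hab (eqv.injective (Subtype.ext h))), map_zero,
        if_neg (fun h => hab h.1)]
  · intro x hx
    rw [LinearMap.mem_ker] at hx
    have hx' : x = ∑ i, (Module.AEval'.of S).symm (L.symm
        (DirectSum.lof K[X] (Fin d) (fun i => K[X] ⧸ Submodule.span K[X] {(X : K[X]) ^ k i}) i
          (co i x))) := by
      rw [← map_sum, ← map_sum, LinearEquiv.eq_symm_apply, LinearEquiv.eq_symm_apply]
      exact (DirectSum.sum_univ_of _).symm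
    rw [hx']
    refine Submodule.sum_mem _ fun i _ => ?_
    have hXi : (X : K[X]) • co i x = 0 := by rw [← hcoS, hx, map_zero]
    obtain ⟨r, hr⟩ | h0 : (∃ r, k i = r + 1) ∨ k i = 0 := by
      rcases k i with _ | r
      · exact Or.inr rfl
      · exact Or.inl ⟨r, rfl⟩
    · have hki : k i ≠ 0 := by omega
      have hsm : ∃ b : K, co i x = b • Submodule.Quotient.mk (X ^ (k i - 1)) := by
        revert hXi
        generalize co i x = y
        revert y
        rw [hr]
        exact fun y hy => eq_smul_of_X_smul_eq_zero r y hy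
      obtain ⟨b, hb⟩ := hsm
      have hL : ∀ (a : K) z, L.symm (a • z) = a • L.symm z := fun a z =>
        L.symm.toLinearMap.map_smul_of_tower a z
      have hterm : (Module.AEval'.of S).symm (L.symm
          (DirectSum.lof K[X] (Fin d) (fun i => K[X] ⧸ Submodule.span K[X] {(X : K[X]) ^ k i}) i
          (co i x))) = b • ve i (X ^ (k i - 1)) := by
        rw [hb, LinearMap.map_smul_of_tower, hL, map_smul]
      rw [hterm]
      refine Submodule.smul_mem _ _ (Submodule.subset_span ⟨eqv.symm ⟨i, hki⟩, ?_⟩)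
      simp only [Equiv.apply_symm_apply]
    · obtain ⟨g, hg⟩ := Submodule.Quotient.mk_surjective _ (co i x)
      rw [← hg]
      have := hve0 i g (by rw [h0, pow_zero]; exact one_dvd g)
      simp only [ve] at this
      rw [this]
      exact zero_mem _

end Jordan

/-! ### The companion operator of a regular pencil -/

section Companion

variable {𝕜 X Y : Type*} [RCLike 𝕜]
  [NormedAddCommGroup X] [NormedSpace 𝕜 X] [NormedAddCommGroup Y] [NormedSpace 𝕜 Y]

/-- The projection of the graph of a linear operator to its domain. -/
def graphToDomain (A : X →ₗ.[𝕜] Y) : A.graph →ₗ[𝕜] A.domain :=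
  (LinearMap.fst 𝕜 X Y ∘ₗ A.graph.subtype).codRestrict A.domain fun p =>
    LinearPMap.mem_domain_of_mem_graph (x := p.1.1) (y := p.1.2) p.2

lemma apply_graphToDomain (A : X →ₗ.[𝕜] Y) (p : A.graph) : A (graphToDomain A p) = p.1.2 := by
  obtain ⟨y, hy1, hy2⟩ := (LinearPMap.mem_graph_iff A).1 p.2
  rw [← hy2]
  congr 1
  exact Subtype.ext hy1.symm

lemma graphToDomain_surjective (A : X →ₗ.[𝕜] Y) (x : A.domain) :
    ∃ p : A.graph, graphToDomain A p = x ∧ p.1.2 = A x :=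
  ⟨⟨(x, A x), A.mem_graph x⟩, rfl, rfl⟩

variable {A B : X →ₗ.[𝕜] Y} (hAB : A.domain ≤ B.domain)

lemma continuous_onDomain_graphToDomain [CompleteSpace X] [CompleteSpace Y] (hA : A.IsClosed)
    (hB : B.IsClosed) : Continuous (onDomain A B hAB ∘ₗ graphToDomain A) := by
  have : CompleteSpace A.graph := IsClosed.completeSpace_coe (hs := hA)
  refine LinearMap.continuous_of_isClosed_graph _ ?_
  have h : ((onDomain A B hAB ∘ₗ graphToDomain A).graph : Set (A.graph × Y)) =
      (fun p : A.graph × Y => ((p.1.1.1, p.2) : X × Y)) ⁻¹' (B.graph : Set (X × Y)) := by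
    ext ⟨p, y⟩
    simp only [SetLike.mem_coe, LinearMap.mem_graph_iff, mem_preimage, LinearPMap.mem_graph_iff]
    constructor
    · rintro rfl
      exact ⟨Submodule.inclusion hAB (graphToDomain A p), rfl, rfl⟩
    · rintro ⟨z, hz, rfl⟩
      change B z = B (Submodule.inclusion hAB (graphToDomain A p))
      congr 1
      exact Subtype.ext hz
  rw [h]
  exact IsClosed.preimage (by fun_prop) hB

/-- `B` is bounded relative to `A`, by the closed graph theorem. -/
lemma exists_relative_bound [CompleteSpace X] [CompleteSpace Y] (hA : A.IsClosed)
    (hB : B.IsClosed) :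
    ∃ β : ℝ, 0 ≤ β ∧ ∀ x : A.domain, ‖onDomain A B hAB x‖ ≤ β * (‖x‖ + ‖A x‖) := by
  let b : A.graph →L[𝕜] Y :=
    ⟨onDomain A B hAB ∘ₗ graphToDomain A, continuous_onDomain_graphToDomain hAB hA hB⟩
  refine ⟨‖b‖, b.opNorm_nonneg, fun x => ?_⟩
  obtain ⟨p, rfl, hp⟩ := graphToDomain_surjective A x
  refine (b.le_opNorm p).trans ?_
  gcongr
  rw [← hp]
  change ‖(p : X × Y)‖ ≤ ‖p.1.1‖ + ‖p.1.2‖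
  exact max_le (le_add_of_nonneg_right (norm_nonneg _)) (le_add_of_nonneg_left (norm_nonneg _))

/-- Regularity of a pencil is only used for large real parameters, where the complex extension of
a pencil of real operators acts componentwise. -/
lemma PencilGrowth.exists_real_bound {k : ℕ} (h : PencilGrowth A B k) :
    ∃ C R : ℝ, 0 < C ∧ 0 < R ∧ ∀ r : ℝ, R ≤ r →
      Function.Bijective (fun x : A.domain => (r : 𝕜) • A x + onDomain A B hAB x) ∧
      ∀ x : A.domain, ‖x‖ ≤ C * r ^ k * ‖(r : 𝕜) • A x + onDomain A B hAB x‖ := by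
  let ι : A.domain → ↥(A.domain ⊓ B.domain) := fun x => ⟨x, x.2, hAB x.2⟩
  let κ : ↥(A.domain ⊓ B.domain) → A.domain := fun u => ⟨u, u.2.1⟩
  by_cases hI : (RCLike.I : 𝕜) = 0
  · obtain ⟨C, R, hC, hR, h⟩ := h.2 hI
    refine ⟨C, R, hC, hR, fun r hr => ?_⟩
    have hr0 : 0 < r := hR.trans_le hr
    have hn : ‖(r : ℂ)‖ = r := by rw [Complex.norm_real, Real.norm_of_nonneg hr0.le]
    obtain ⟨⟨hinj, hsurj⟩, hb⟩ := h (r : ℂ) (by rw [hn]; exact hr)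
    have heval : ∀ u, complexifiedPencil A B (r : ℂ) u =
        ((r : 𝕜) • A (κ u.1) + onDomain A B hAB (κ u.1),
          (r : 𝕜) • A (κ u.2) + onDomain A B hAB (κ u.2)) := by
      intro u
      simp only [complexifiedPencil, Complex.ofReal_re, Complex.ofReal_im, RCLike.ofReal_zero,
        zero_smul, sub_zero, zero_add]
      rfl
    refine ⟨⟨fun x x' hx => ?_, fun y => ?_⟩, fun x => ?_⟩
    · simp only at hx
      have : ((ι x, ι 0) : _ × _) = (ι x', ι 0) := hinj (by
        rw [heval, heval]
        exact Prod.ext hx rfl)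
      exact congrArg (fun u => κ u.1) this
    · obtain ⟨u, hu⟩ := hsurj (y, 0)
      rw [heval] at hu
      exact ⟨κ u.1, congrArg Prod.fst hu⟩
    · have h1 := hb (ι x, ι 0)
      rw [heval, hn] at h1
      have h0 : (r : 𝕜) • A (κ (ι 0)) + onDomain A B hAB (κ (ι 0)) = 0 := by
        have : κ (ι 0) = 0 := rfl
        rw [this, LinearPMap.map_zero, map_zero, smul_zero, add_zero]
      simp only [h0] at h1
      rw [Prod.norm_def, Prod.norm_def, norm_zero, max_eq_left (norm_nonneg _)] at h1
      exact (le_max_left _ _).trans h1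
  · obtain ⟨C, R, hC, hR, h⟩ := h.1 hI
    refine ⟨C, R, hC, hR, fun r hr => ?_⟩
    have hr0 : 0 < r := hR.trans_le hr
    have hn : ‖(r : 𝕜)‖ = r := by rw [RCLike.norm_ofReal, abs_of_pos hr0]
    obtain ⟨⟨hinj, hsurj⟩, hb⟩ := h (r : 𝕜) (by rw [hn]; exact hr)
    refine ⟨⟨fun x x' hx => ?_, fun y => ?_⟩, fun x => ?_⟩
    · exact congrArg κ (hinj (a₁ := ι x) (a₂ := ι x') hx)
    · obtain ⟨u, hu⟩ := hsurj y
      exact ⟨κ u, hu⟩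
    · have h1 := hb (ι x)
      rw [hn] at h1
      exact h1

/-- For a large real `r`, the operator `T = A (r A + B)⁻¹` on `Y` is bounded, its kernels
`ker (T ^ j)` are constant from some `p` on, and `ker (T ^ p)` and the range of `T` span `Y`. -/
theorem exists_companion [CompleteSpace X] [CompleteSpace Y] (hA : A.IsClosed) (hB : B.IsClosed)
    (hrange : IsClosed (LinearMap.range A.toFun : Set Y))
    (hker : FiniteDimensional 𝕜 (LinearMap.ker A.toFun)) {k : ℕ} (h : PencilGrowth A B k) :
    ∃ (r : ℝ) (e : A.domain ≃ₗ[𝕜] Y) (T : Y →L[𝕜] Y) (p : ℕ),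
      (∀ x, e x = (r : 𝕜) • A x + onDomain A B hAB x) ∧ (∀ x, T (e x) = A x) ∧ 1 ≤ p ∧
      LinearMap.ker ((T : Y →ₗ[𝕜] Y) ^ (p + 1)) ≤ LinearMap.ker ((T : Y →ₗ[𝕜] Y) ^ p) ∧
      FiniteDimensional 𝕜 (LinearMap.ker ((T : Y →ₗ[𝕜] Y) ^ p)) ∧
      LinearMap.range (T : Y →ₗ[𝕜] Y) ⊔ LinearMap.ker ((T : Y →ₗ[𝕜] Y) ^ p) = ⊤ := by
  obtain ⟨β, hβ, hrel⟩ := exists_relative_bound hAB hA hB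
  obtain ⟨C, R, hC, hR, hreg⟩ := h.exists_real_bound hAB
  set b := onDomain A B hAB with hb
  set r₀ : ℝ := max R (β + 1) with hr₀
  have hr₀R : R ≤ r₀ := le_max_left _ _
  have hr₀β : β + 1 ≤ r₀ := le_max_right _ _
  have hr₀1 : 1 ≤ r₀ := by linarith
  set M : ℝ := 1 + β * C with hM
  have hM0 : 0 < M := by positivity
  -- the relative bound turns the bound for `R(r)` into a bound for `A R(r)`
  have hAbound : ∀ r, r₀ ≤ r → ∀ x : A.domain, ‖A x‖ ≤ M * r ^ k * ‖(r : 𝕜) • A x + b x‖ := by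
    intro r hr x
    have hr1 : 1 ≤ r := hr₀1.trans hr
    have h1 : r * ‖A x‖ ≤ ‖(r : 𝕜) • A x + b x‖ + ‖b x‖ := by
      have : ‖(r : 𝕜) • A x‖ = r * ‖A x‖ := by
        rw [norm_smul, RCLike.norm_ofReal, abs_of_pos (by linarith)]
      rw [← this]
      calc ‖(r : 𝕜) • A x‖ = ‖((r : 𝕜) • A x + b x) - b x‖ := by rw [add_sub_cancel_right]
        _ ≤ _ := norm_sub_le _ _
    have h2 := hrel x
    have h3 := (hreg r (hr₀R.trans hr)).2 x
    set P := ‖(r : 𝕜) • A x + b x‖ with hP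
    have hP0 : 0 ≤ P := norm_nonneg _
    have h4 : β * ‖x‖ ≤ β * (C * r ^ k * P) := by gcongr
    have h5 : ‖A x‖ ≤ (r - β) * ‖A x‖ := le_mul_of_one_le_left (norm_nonneg _) (by linarith)
    have h6 : P ≤ r ^ k * P := le_mul_of_one_le_left hP0 (one_le_pow₀ hr1)
    rw [hM]
    nlinarith
  let L : A.domain →ₗ[𝕜] Y := (r₀ : 𝕜) • A.toFun + b
  let e : A.domain ≃ₗ[𝕜] Y := LinearEquiv.ofBijective L (hreg r₀ hr₀R).1
  have he : ∀ x, e x = (r₀ : 𝕜) • A x + b x := fun x => rfl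
  let T₀ : Y →ₗ[𝕜] Y := A.toFun ∘ₗ e.symm.toLinearMap
  have hT₀e : ∀ x, T₀ (e x) = A x := fun x => by
    simp only [T₀, LinearMap.comp_apply, LinearEquiv.coe_coe, LinearEquiv.symm_apply_apply]
    rfl
  let T : Y →L[𝕜] Y := T₀.mkContinuous (M * r₀ ^ k) fun y => by
    obtain ⟨x, rfl⟩ := e.surjective y
    rw [hT₀e]
    exact hAbound r₀ le_rfl x
  have hTT₀ : (T : Y →ₗ[𝕜] Y) = T₀ := rfl
  have hTe : ∀ x, T (e x) = A x := hT₀e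
  have hrangeT : LinearMap.range (T : Y →ₗ[𝕜] Y) = LinearMap.range A.toFun := by
    ext y
    constructor
    · rintro ⟨z, rfl⟩
      exact ⟨e.symm z, rfl⟩
    · rintro ⟨x, rfl⟩
      exact ⟨e x, hTe x⟩
  have hshift : ∀ (μ : ℝ) x, e x + (μ : 𝕜) • T (e x) = ((r₀ + μ : ℝ) : 𝕜) • A x + b x := by
    intro μ x
    rw [hTe, he, RCLike.ofReal_add, add_smul]
    abel
  have hsurj : ∀ μ : ℝ, 0 ≤ μ → Function.Surjective fun y => y + (μ : 𝕜) • T y := by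
    intro μ hμ y
    obtain ⟨x, hx⟩ := (hreg (r₀ + μ) (by linarith)).1.2 y
    exact ⟨e x, (hshift μ x).trans hx⟩
  have hres : ∀ μ : ℝ, 0 ≤ μ → ∀ y,
      ‖y‖ ≤ (1 + M * r₀ ^ k) * (1 + μ) ^ (k + 1) * ‖y + (μ : 𝕜) • T y‖ := by
    intro μ hμ y
    obtain ⟨x, rfl⟩ := e.surjective y
    have h1 := hAbound (r₀ + μ) (by linarith) x
    rw [← hshift] at h1
    set P := ‖e x + (μ : 𝕜) • T (e x)‖ with hP
    have hP0 : 0 ≤ P := norm_nonneg _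
    have h2 : ‖e x‖ ≤ P + μ * ‖A x‖ := by
      have : ‖(μ : 𝕜) • T (e x)‖ = μ * ‖A x‖ := by
        rw [norm_smul, RCLike.norm_ofReal, abs_of_nonneg hμ, hTe]
      rw [← this]
      calc ‖e x‖ = ‖(e x + (μ : 𝕜) • T (e x)) - (μ : 𝕜) • T (e x)‖ := by rw [add_sub_cancel_right]
        _ ≤ _ := norm_sub_le _ _
    have h3 : (r₀ + μ) ^ k ≤ (r₀ * (1 + μ)) ^ k := by
      gcongr
      nlinarith
    calc ‖e x‖ ≤ P + μ * ‖A x‖ := h2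
      _ ≤ P + (1 + μ) * (M * (r₀ * (1 + μ)) ^ k * P) := by
        gcongr
        · linarith
        · exact h1.trans (by gcongr)
      _ ≤ (1 + μ) ^ (k + 1) * P + (1 + μ) * (M * (r₀ * (1 + μ)) ^ k * P) := by
        gcongr
        exact le_mul_of_one_le_left hP0 (one_le_pow₀ (by linarith))
      _ = _ := by rw [mul_pow]; ring
  have hpowker : LinearMap.ker ((T : Y →ₗ[𝕜] Y) ^ (k + 2 + 1)) ≤
      LinearMap.ker ((T : Y →ₗ[𝕜] Y) ^ (k + 2)) := by
    intro y hy
    rw [LinearMap.mem_ker, ← ContinuousLinearMap.toLinearMap_pow] at hy ⊢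
    exact ker_pow_le_of_resolvent_bound T hres hy
  have hkerT : FiniteDimensional 𝕜 (LinearMap.ker (T : Y →ₗ[𝕜] Y)) := by
    have hmap : ∀ y ∈ LinearMap.ker (T : Y →ₗ[𝕜] Y), e.symm y ∈ LinearMap.ker A.toFun :=
      fun y hy => hy
    refine FiniteDimensional.of_injective
      ((e.symm.toLinearMap).restrict hmap) fun y z hyz => ?_
    exact Subtype.ext (e.symm.injective (congrArg Subtype.val hyz))
  have hfin := finiteDimensional_ker_pow (T := (T : Y →ₗ[𝕜] Y)) (k + 2)
  exact ⟨r₀, e, T, k + 2, he, hTe, by omega, hpowker, hfin,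
    range_sup_ker_pow_eq_top T hpowker (hrangeT ▸ hrange) hsurj⟩

/-- The operator `A` of a regular pencil has index zero. -/
theorem finrank_quotient_range_of_regular [CompleteSpace X] [CompleteSpace Y] (hA : A.IsClosed)
    (hB : B.IsClosed) (hAB : A.domain ≤ B.domain)
    (hrange : IsClosed (LinearMap.range A.toFun : Set Y))
    (hker : FiniteDimensional 𝕜 (LinearMap.ker A.toFun)) {ν : ℕ}
    (hν : IsRegularPencilOfIndex A B ν) :
    FiniteDimensional 𝕜 (Y ⧸ LinearMap.range A.toFun) ∧
      Module.finrank 𝕜 (Y ⧸ LinearMap.range A.toFun) =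
        Module.finrank 𝕜 (LinearMap.ker A.toFun) := by
  cases ν with
  | zero =>
    obtain ⟨-, ⟨hinj, hsurj⟩, -⟩ := hν
    have h1 : LinearMap.range A.toFun = ⊤ := LinearMap.range_eq_top.2 hsurj
    have h2 : LinearMap.ker A.toFun = ⊥ := LinearMap.ker_eq_bot.2 hinj
    have hsub : Subsingleton (Y ⧸ LinearMap.range A.toFun) :=
      Submodule.Quotient.subsingleton_iff.2 h1
    refine ⟨inferInstance, ?_⟩
    rw [Module.finrank_zero_of_subsingleton, h2, finrank_bot]
  | succ k =>
    obtain ⟨r, e, T, p, he, hTe, hp, hpowker, hfin, hsup⟩ :=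
      exists_companion hAB hA hB hrange hker (hν : IsLeast _ _).1
    have hrangeT : LinearMap.range (T : Y →ₗ[𝕜] Y) = LinearMap.range A.toFun := by
      ext y
      constructor
      · rintro ⟨z, rfl⟩
        obtain ⟨x, rfl⟩ := e.surjective z
        exact ⟨x, (hTe x).symm⟩
      · rintro ⟨x, rfl⟩
        exact ⟨e x, hTe x⟩
    have hkerT : Module.finrank 𝕜 (LinearMap.ker (T : Y →ₗ[𝕜] Y)) =
        Module.finrank 𝕜 (LinearMap.ker A.toFun) := by
      have hcomp : (T : Y →ₗ[𝕜] Y) ∘ₗ e.toLinearMap = A.toFun := LinearMap.ext hTe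
      rw [← hcomp, LinearMap.ker_comp]
      have := (e.submoduleMap ((LinearMap.ker (T : Y →ₗ[𝕜] Y)).comap e.toLinearMap)).finrank_eq
      rwa [Submodule.map_comap_eq_of_surjective e.surjective, eq_comm] at this
    have := finrank_quotient_range hp hpowker hsup
    rw [hrangeT, hkerT] at this
    exact this

end Companion

/-! ### Existence of root systems -/

section Existence

variable {𝕜 X Y : Type*} [RCLike 𝕜]
  [NormedAddCommGroup X] [NormedSpace 𝕜 X] [NormedAddCommGroup Y] [NormedSpace 𝕜 Y]
  {A B : X →ₗ.[𝕜] Y}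

/-- Root systems of a regular pencil exist. On the generalized kernel `N` of the companion operator
`T = A (r A + B)⁻¹` the operator `B (r A + B)⁻¹ = 1 - r T` is invertible, and the root vectors are
the preimages under `B` of Jordan chains of the nilpotent operator `- T (1 - r T)⁻¹` of `N`. -/
theorem nonempty_rootSystem [CompleteSpace X] [CompleteSpace Y] (hA : A.IsClosed)
    (hB : B.IsClosed) (hAB : A.domain ≤ B.domain)
    (hrange : IsClosed (LinearMap.range A.toFun : Set Y))
    (hker : FiniteDimensional 𝕜 (LinearMap.ker A.toFun)) {ν : ℕ}
    (hν : IsRegularPencilOfIndex A B ν) : Nonempty (RootSystem A B hAB) := by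
  cases ν with
  | zero =>
    obtain ⟨-, ⟨hinj, -⟩, -⟩ := hν
    exact ⟨{
      n := 0
      m := fun i => i.elim0
      one_le_m := fun i => i.elim0
      φ := fun i => i.elim0
      q := fun i => i.elim0
      linearIndependent_eigenvectors := linearIndependent_empty_type
      span_eigenvectors := by
        rw [range_eq_empty, Submodule.span_empty, eq_comm]
        exact LinearMap.ker_eq_bot.2 hinj
      chain := fun i => i.elim0
      adjoint_last := fun i => i.elim0
      adjoint_chain := fun i => i.elim0
      biorthogonal := fun i => i.elim0 }⟩
  | succ k =>
    obtain ⟨r, e, T, p, he, hTe, hp, hpowker, hfin, hsup⟩ :=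
      exists_companion hAB hA hB hrange hker (hν : IsLeast _ _).1
    set N := LinearMap.ker ((T : Y →ₗ[𝕜] Y) ^ p) with hN
    have hcompl : IsCompl N (LinearMap.range ((T : Y →ₗ[𝕜] Y) ^ p)) :=
      isCompl_ker_pow_range_pow hpowker hsup
    set V := LinearMap.range ((T : Y →ₗ[𝕜] Y) ^ p) with hV
    let π : Y →ₗ[𝕜] N := N.projectionOnto V hcompl
    let TN : N →ₗ[𝕜] N := (T : Y →ₗ[𝕜] Y).restrict fun y hy => map_mem_ker_pow hy
    have hTN : ∀ y : N, ((TN y : N) : Y) = T y := fun y => rfl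
    have hTV : ∀ y ∈ V, T y ∈ V := by
      rintro _ ⟨z, rfl⟩
      refine ⟨T z, ?_⟩
      change (((T : Y →ₗ[𝕜] Y) ^ p) * (T : Y →ₗ[𝕜] Y)) z = ((T : Y →ₗ[𝕜] Y) * (T : Y →ₗ[𝕜] Y) ^ p) z
      rw [← pow_succ, pow_succ']
    have hπN : ∀ y : N, π y = y := fun y => Submodule.projectionOnto_apply_left hcompl y
    have hπV : ∀ y ∈ V, π y = 0 := fun y hy =>
      (Submodule.projectionOnto_apply_eq_zero_iff hcompl).2 hy
    have hπT : ∀ y, π (T y) = TN (π y) := by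
      intro y
      obtain ⟨n, hn, v, hv, rfl⟩ := Submodule.mem_sup.1
        (hcompl.sup_eq_top ▸ Submodule.mem_top : y ∈ N ⊔ V)
      rw [map_add, map_add, map_add, hπV v hv, hπV _ (hTV v hv), add_zero, add_zero]
      rw [hπN ⟨n, hn⟩]
      exact hπN (TN ⟨n, hn⟩)
    have hTNnil : IsNilpotent TN := by
      refine ⟨p, ?_⟩
      have hpow : ∀ j (y : N), (((TN ^ j) y : N) : Y) = ((T : Y →ₗ[𝕜] Y) ^ j) y := by
        intro j
        induction j with
        | zero => intro y; rfl
        | succ j ih =>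
          intro y
          rw [pow_succ, pow_succ, Module.End.mul_apply, Module.End.mul_apply, ih]
          rfl
      ext y
      rw [hpow]
      exact y.2
    -- `U` is the restriction of `B (r A + B)⁻¹` to `N`
    let U : Module.End 𝕜 N := 1 - (r : 𝕜) • TN
    obtain ⟨u, hu⟩ : IsUnit U := (hTNnil.smul (r : 𝕜)).isUnit_one_sub
    let Vi : Module.End 𝕜 N := ↑u⁻¹
    have hUV : ∀ y, U (Vi y) = y := fun y => by
      have : U * Vi = 1 := by rw [← hu]; exact u.mul_inv
      exact congrArg (fun S : Module.End 𝕜 N => S y) this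
    have hVU : ∀ y, Vi (U y) = y := fun y => by
      have : Vi * U = 1 := by rw [← hu]; exact u.inv_mul
      exact congrArg (fun S : Module.End 𝕜 N => S y) this
    have hcomm : Commute TN U := by
      refine (Commute.one_right TN).sub_right ?_
      exact (Commute.refl TN).smul_right (r : 𝕜)
    have hcommV : Commute TN Vi := by
      have : Commute TN (u : Module.End 𝕜 N) := by rw [hu]; exact hcomm
      exact this.units_inv_right
    let S : N →ₗ[𝕜] N := -(TN * Vi)
    have hSnil : IsNilpotent S := (hcommV.isNilpotent_mul_right hTNnil).neg
    obtain ⟨n, m, c, q, hm, hc1, hcs, hqm, hqs, hbi, hcker⟩ := exists_jordan_chains S hSnil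
    have hBe : ∀ x, onDomain A B hAB x = e x - (r : 𝕜) • T (e x) := fun x => by
      rw [hTe, he]; abel
    let φ : Fin n → ℕ → A.domain := fun i j => e.symm (Vi (c i j) : N)
    have heφ : ∀ i j, e (φ i j) = (Vi (c i j) : N) := fun i j => e.apply_symm_apply _
    have hBφ : ∀ i j, onDomain A B hAB (φ i j) = (c i j : N) := by
      intro i j
      have h1 : ((U (Vi (c i j)) : N) : Y) = (c i j : N) := by rw [hUV]
      rw [hBe, heφ, ← h1]
      rfl
    have hAφ : ∀ i j, A (φ i j) = -((S (c i j) : N) : Y) := by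
      intro i j
      rw [← hTe, heφ]
      change _ = -(-((TN (Vi (c i j)) : N) : Y))
      rw [neg_neg, hTN]
    have hqcont : ∀ i j, Continuous (q i j ∘ₗ π) := fun i j => by
      refine continuous_of_vanishes_on_range (T ^ p) N ?_ _ fun y => ?_
      · rw [ContinuousLinearMap.toLinearMap_pow, ← hV, sup_comm]
        exact hcompl.sup_eq_top
      · have : (T ^ p) y ∈ V := by
          refine ⟨y, ?_⟩
          rw [← ContinuousLinearMap.toLinearMap_pow]
          rfl
        rw [LinearMap.comp_apply, hπV _ this, map_zero]
    have hπB : ∀ x, π (onDomain A B hAB x) = U (π (e x)) := fun x => by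
      rw [hBe, map_sub, map_smul, hπT]
      rfl
    have hπA : ∀ x, π (A x) = -S (π (onDomain A B hAB x)) := fun x => by
      rw [← hTe, hπT, hπB]
      change _ = -(-(TN (Vi (U (π (e x))))))
      rw [neg_neg, hVU]
    have hBN : ∀ x, A x = 0 → onDomain A B hAB x = e x := fun x hx => by
      rw [hBe, hTe, hx, smul_zero, sub_zero]
    have hBinj : ∀ x, A x = 0 → onDomain A B hAB x = 0 → x = 0 := fun x hx hbx => by
      rw [hBN x hx] at hbx
      exact e.map_eq_zero_iff.1 hbx
    have hφker : ∀ i, A (φ i 1) = 0 := fun i => by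
      rw [hAφ, hc1, Submodule.coe_zero, neg_zero]
    refine ⟨{
      n := n
      m := m
      one_le_m := hm
      φ := φ
      q := fun i j => ⟨q i j ∘ₗ π, hqcont i j⟩
      linearIndependent_eigenvectors := ?_
      span_eigenvectors := le_antisymm ?_ ?_
      chain := ?_
      adjoint_last := ?_
      adjoint_chain := ?_
      biorthogonal := ?_ }⟩
    · rw [Fintype.linearIndependent_iff]
      intro a ha i
      have h1 : ∑ l, a l • ((c l 1 : N)) = 0 := by
        refine Subtype.ext ?_
        have := congrArg (onDomain A B hAB) ha
        rw [map_sum, map_zero] at this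
        simp only [map_smul, hBφ] at this
        rw [Submodule.coe_sum]
        exact this
      have h2 := congrArg (q i 1) h1
      rw [map_sum, map_zero] at h2
      simp only [map_smul, hbi _ 1 i 1 le_rfl (hm _) le_rfl (hm i), smul_eq_mul, and_true, mul_ite,
        mul_one, mul_zero, Finset.sum_ite_eq', Finset.mem_univ, if_true] at h2
      exact h2
    · rw [Submodule.span_le]
      rintro _ ⟨i, rfl⟩
      exact hφker i
    · intro x hx
      have hAx : A x = 0 := hx
      have hex : e x ∈ N := by
        rw [hN, LinearMap.mem_ker]
        obtain ⟨p', rfl⟩ : ∃ p', p = p' + 1 := ⟨p - 1, by omega⟩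
        rw [pow_succ, Module.End.mul_apply]
        change ((T : Y →ₗ[𝕜] Y) ^ p') (T (e x)) = 0
        rw [hTe, hAx, map_zero]
      have hSx : (⟨e x, hex⟩ : N) ∈ LinearMap.ker S := by
        rw [LinearMap.mem_ker]
        change -(TN (Vi _)) = 0
        have h1 : TN (Vi ⟨e x, hex⟩) = Vi (TN ⟨e x, hex⟩) :=
          congrArg (fun S : Module.End 𝕜 N => S ⟨e x, hex⟩) hcommV
        have h2 : TN ⟨e x, hex⟩ = 0 := Subtype.ext ((hTe x).trans hAx)
        rw [h1, h2, map_zero, neg_zero]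
      obtain ⟨a, ha⟩ := (Submodule.mem_span_range_iff_exists_fun 𝕜).1 (hcker hSx)
      have hx' : x = ∑ i, a i • φ i 1 := by
        rw [← sub_eq_zero]
        refine hBinj _ ?_ ?_
        · change A.toFun _ = 0
          rw [map_sub, map_sum]
          have : ∀ i, A.toFun (a i • φ i 1) = 0 := fun i => by
            rw [map_smul]
            exact (congrArg _ (hφker i)).trans (smul_zero _)
          simp only [this, Finset.sum_const_zero, sub_zero]
          exact hAx
        · rw [map_sub, map_sum, hBN x hAx]
          simp only [map_smul, hBφ]
          have := congrArg Subtype.val ha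
          rw [Submodule.coe_sum] at this
          rw [sub_eq_zero]
          exact this.symm
      rw [hx']
      exact Submodule.sum_mem _ fun i _ => Submodule.smul_mem _ _ (Submodule.subset_span ⟨i, rfl⟩)
    · intro i j hj hjm
      rw [hAφ, hBφ, hcs i j hj hjm]
    · intro i x
      change q i (m i) (π (A x)) = 0
      rw [hπA, map_neg, hqm, neg_zero]
    · intro i j hj hjm x
      change q i j (π (A x)) = -(q i (j + 1) (π _))
      rw [hπA, map_neg, hqs i j hj hjm]
    · intro i j k l hj hjm hl hlm
      change q k l (π (onDomain A B hAB (φ i j))) = _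
      rw [hBφ, hπN]
      exact hbi i j k l hj hjm hl hlm

end Existence

/-! ### Locally Lipschitz implicit functions -/

section Implicit

variable {𝕜 E H Z : Type*} [RCLike 𝕜] [NormedAddCommGroup E]
  [NormedAddCommGroup H] [NormedSpace 𝕜 H] [CompleteSpace H]
  [NormedAddCommGroup Z] [NormedSpace 𝕜 Z]

/-- A perturbation `G` of an isomorphism `Λ` by a sufficiently small Lipschitz map has a zero in a
closed ball at whose centre `G` is small. -/
lemma exists_zero_of_approximates {G : H → Z} {u' : H} {Λ : H ≃L[𝕜] Z} {q ε : ℝ} (hε : 0 ≤ ε)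
    (hq : 0 ≤ q) (hqΛ : ‖(Λ.symm : Z →L[𝕜] H)‖ * q < 1)
    (hG : ∀ u v, ‖u - u'‖ ≤ ε → ‖v - u'‖ ≤ ε → ‖G u - G v - Λ (u - v)‖ ≤ q * ‖u - v‖)
    (hsmall : ‖(Λ.symm : Z →L[𝕜] H)‖ * ‖G u'‖ ≤ (1 - ‖(Λ.symm : Z →L[𝕜] H)‖ * q) * ε) :
    ∃ u, ‖u - u'‖ ≤ ε ∧ G u = 0 := by
  set κ := ‖(Λ.symm : Z →L[𝕜] H)‖ with hκ
  have hκ0 : 0 ≤ κ := norm_nonneg _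
  set s := Metric.closedBall u' ε with hs
  have hmem : ∀ u, u ∈ s ↔ ‖u - u'‖ ≤ ε := fun u => by
    rw [hs, Metric.mem_closedBall, dist_eq_norm]
  let Φ : H → H := fun u => u - Λ.symm (G u)
  have hΦ : ∀ u ∈ s, ∀ v ∈ s, ‖Φ u - Φ v‖ ≤ κ * q * ‖u - v‖ := by
    intro u hu v hv
    have h1 : Φ u - Φ v = -(Λ.symm (G u - G v - Λ (u - v))) := by
      simp only [Φ, map_sub, ContinuousLinearEquiv.symm_apply_apply]; abel
    rw [h1, norm_neg, mul_assoc]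
    refine ((Λ.symm : Z →L[𝕜] H).le_opNorm _).trans ?_
    gcongr
    exact hG u v ((hmem u).1 hu) ((hmem v).1 hv)
  have hu's : u' ∈ s := Metric.mem_closedBall_self hε
  have hmaps : MapsTo Φ s s := by
    intro u hu
    rw [hmem]
    have h1 := hΦ u hu u' hu's
    have h2 : ‖Φ u' - u'‖ ≤ κ * ‖G u'‖ := by
      have : Φ u' - u' = -(Λ.symm (G u')) := by simp only [Φ]; abel
      rw [this, norm_neg]
      exact (Λ.symm : Z →L[𝕜] H).le_opNorm _
    calc ‖Φ u - u'‖ = ‖(Φ u - Φ u') + (Φ u' - u')‖ := by congr 1; abel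
      _ ≤ ‖Φ u - Φ u'‖ + ‖Φ u' - u'‖ := norm_add_le _ _
      _ ≤ κ * q * ‖u - u'‖ + κ * ‖G u'‖ := add_le_add h1 h2
      _ ≤ κ * q * ε + (1 - κ * q) * ε := by
        gcongr
        exact (hmem u).1 hu
      _ = ε := by ring
  have hcontr : ContractingWith ⟨κ * q, by positivity⟩ (hmaps.restrict Φ s s) := by
    refine ⟨hqΛ, LipschitzWith.of_dist_le_mul fun u v => ?_⟩
    rw [Subtype.dist_eq, Subtype.dist_eq, dist_eq_norm, dist_eq_norm]
    exact hΦ u u.2 v v.2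
  obtain ⟨u, hu, hfix, -, -⟩ :=
    hcontr.exists_fixedPoint' Metric.isClosed_closedBall.isComplete hmaps
    hu's (edist_ne_top _ _)
  refine ⟨u, (hmem u).1 hu, ?_⟩
  have h1 : u - Λ.symm (G u) = u := hfix
  have h2 : Λ.symm (G u) = 0 := by rwa [sub_eq_self] at h1
  exact Λ.symm.map_eq_zero_iff.1 h2

/-- A function `φ` that is locally the only solution of `F t w (φ t w) = 0` is continuous and
Lipschitz in `w` near a point where `F` is approximated by an isomorphism in the last variable.
The uniqueness is only assumed near the point, where the contraction principle yields a
solution. -/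
lemma implicit_function_lipschitz {F : ℝ → E → H → Z} {U : Set E} {φ : ℝ → E → H} {t' : ℝ}
    {w' : E} (ht' : 0 ≤ t') (hw' : w' ∈ U)
    (hφ : ∀ t, 0 ≤ t → ∀ w ∈ U, F t w (φ t w) = 0)
    (huniq : ∃ ρ : ℝ, 0 < ρ ∧ ∀ t, 0 ≤ t → |t - t'| < ρ → ∀ w ∈ U, ‖w - w'‖ < ρ →
      ∀ u, ‖u - φ t' w'‖ < ρ → F t w u = 0 → u = φ t w)
    (hcont : ContinuousWithinAt (fun p : ℝ × E => F p.1 p.2 (φ t' w')) (Ici 0 ×ˢ U) (t', w'))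
    (hLip : ∃ r L : ℝ, 0 < r ∧ 0 ≤ L ∧ ∀ t, 0 ≤ t → |t - t'| < r → ∀ w₁ w₂,
      ‖w₁ - w'‖ < r → ‖w₂ - w'‖ < r → ∀ u, ‖u - φ t' w'‖ < r →
      ‖F t w₁ u - F t w₂ u‖ ≤ L * ‖w₁ - w₂‖)
    (happrox : ∃ (Λ : H ≃L[𝕜] Z) (q δ : ℝ), 0 < δ ∧ 0 ≤ q ∧
      ‖(Λ.symm : Z →L[𝕜] H)‖ * q < 1 ∧ ∀ t, 0 ≤ t → |t - t'| < δ → ∀ w ∈ U, ‖w - w'‖ < δ →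
      ∀ u v, ‖u - φ t' w'‖ < δ → ‖v - φ t' w'‖ < δ →
      ‖F t w u - F t w v - Λ (u - v)‖ ≤ q * ‖u - v‖) :
    ContinuousWithinAt (fun p : ℝ × E => φ p.1 p.2) (Ici 0 ×ˢ U) (t', w') ∧
    ∃ r L : ℝ, 0 < r ∧ 0 ≤ L ∧ ∀ t, 0 ≤ t → |t - t'| < r → ∀ w₁ ∈ U, ∀ w₂ ∈ U,
      ‖w₁ - w'‖ < r → ‖w₂ - w'‖ < r → ‖φ t w₁ - φ t w₂‖ ≤ L * ‖w₁ - w₂‖ := by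
  obtain ⟨ρ, hρ, huniq⟩ := huniq
  obtain ⟨rL, L, hrL, hL, hLip⟩ := hLip
  obtain ⟨Λ, q, δ, hδ, hq, hqΛ, happrox⟩ := happrox
  set u' := φ t' w' with hu'
  set κ := ‖(Λ.symm : Z →L[𝕜] H)‖ with hκ
  have hκ0 : 0 ≤ κ := norm_nonneg _
  have hgap : 0 < 1 - κ * q := by linarith
  set ε := min (min ρ rL) δ / 2 with hε
  have hmin : 0 < min (min ρ rL) δ := by positivity
  have hε0 : 0 < ε := by positivity
  have hεlt : ε < min (min ρ rL) δ := by rw [hε]; linarith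
  have hερ : ε < ρ := hεlt.trans_le ((min_le_left _ _).trans (min_le_left _ _))
  have hεr : ε < rL := hεlt.trans_le ((min_le_left _ _).trans (min_le_right _ _))
  have hεδ : ε < δ := hεlt.trans_le (min_le_right _ _)
  have hF0 : F t' w' u' = 0 := hφ t' ht' w' hw'
  -- `F t w u'` is small near the base point
  have hsmall : ∀ᶠ p : ℝ × E in 𝓝[Ici 0 ×ˢ U] (t', w'), κ * ‖F p.1 p.2 u'‖ ≤ (1 - κ * q) * ε := by
    have h1 : Tendsto (fun p : ℝ × E => κ * ‖F p.1 p.2 u'‖) (𝓝[Ici 0 ×ˢ U] (t', w')) (𝓝 0) := by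
      have h := (hcont.norm).const_mul κ
      simpa [ContinuousWithinAt, hF0] using h
    exact h1.eventually_le_const (by positivity)
  obtain ⟨σ, hσ, hsmall⟩ := Metric.mem_nhdsWithin_iff.1 hsmall
  set r := min (min (min ρ rL) δ) σ with hr
  have hr0 : 0 < r := by positivity
  have hrρ : r ≤ ρ := (min_le_left _ _).trans ((min_le_left _ _).trans (min_le_left _ _))
  have hrrL : r ≤ rL := (min_le_left _ _).trans ((min_le_left _ _).trans (min_le_right _ _))
  have hrδ : r ≤ δ := (min_le_left _ _).trans (min_le_right _ _)
  have hrσ : r ≤ σ := min_le_right _ _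
  have hball : ∀ t, 0 ≤ t → |t - t'| < r → ∀ w ∈ U, ‖w - w'‖ < r → ‖φ t w - u'‖ ≤ ε := by
    intro t ht htr w hw hwr
    have hs : κ * ‖F t w u'‖ ≤ (1 - κ * q) * ε := by
      refine @hsmall (t, w) ⟨?_, ht, hw⟩
      rw [Metric.mem_ball, Prod.dist_eq, Real.dist_eq, dist_eq_norm]
      exact max_lt (htr.trans_le hrσ) (hwr.trans_le hrσ)
    obtain ⟨u, hu, hu0⟩ := exists_zero_of_approximates hε0.le hq hqΛ
      (fun u v hu hv => happrox t ht (htr.trans_le hrδ) w hw (hwr.trans_le hrδ) u v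
        (hu.trans_lt hεδ) (hv.trans_lt hεδ)) hs
    rw [← huniq t ht (htr.trans_le hrρ) w hw (hwr.trans_le hrρ) u (hu.trans_lt hερ) hu0]
    exact hu
  -- the distance of a zero from another point is controlled by the value there
  have hdist : ∀ t, 0 ≤ t → |t - t'| < r → ∀ w ∈ U, ‖w - w'‖ < r → ∀ v, ‖v - u'‖ ≤ ε →
      ‖φ t w - v‖ ≤ κ / (1 - κ * q) * ‖F t w v‖ := by
    intro t ht htr w hw hwr v hv
    have h1 := happrox t ht (htr.trans_le hrδ) w hw (hwr.trans_le hrδ) (φ t w) v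
      ((hball t ht htr w hw hwr).trans_lt hεδ) (hv.trans_lt hεδ)
    rw [hφ t ht w hw, zero_sub] at h1
    have h2 : ‖Λ (φ t w - v)‖ ≤ ‖F t w v‖ + q * ‖φ t w - v‖ := by
      calc ‖Λ (φ t w - v)‖ = ‖-(F t w v) - (-(F t w v) - Λ (φ t w - v))‖ := by congr 1; abel
        _ ≤ ‖-(F t w v)‖ + ‖-(F t w v) - Λ (φ t w - v)‖ := norm_sub_le _ _
        _ ≤ _ := by rw [norm_neg]; gcongr
    have h3 : ‖φ t w - v‖ ≤ κ * ‖Λ (φ t w - v)‖ := by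
      have := (Λ.symm : Z →L[𝕜] H).le_opNorm (Λ (φ t w - v))
      simpa using this
    have h4 : (1 - κ * q) * ‖φ t w - v‖ ≤ κ * ‖F t w v‖ := by
      have := h3.trans (mul_le_mul_of_nonneg_left h2 hκ0)
      linarith
    rw [div_mul_eq_mul_div, le_div_iff₀ hgap, mul_comm]
    exact h4
  refine ⟨?_, r, κ / (1 - κ * q) * L, hr0, by positivity, ?_⟩
  · have h0 : Tendsto (fun p : ℝ × E => κ / (1 - κ * q) * ‖F p.1 p.2 u'‖)
        (𝓝[Ici 0 ×ˢ U] (t', w')) (𝓝 0) := by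
      have h := (hcont.norm).const_mul (κ / (1 - κ * q))
      simpa [ContinuousWithinAt, hF0] using h
    have hev : ∀ᶠ p : ℝ × E in 𝓝[Ici 0 ×ˢ U] (t', w'),
        ‖φ p.1 p.2 - u'‖ ≤ κ / (1 - κ * q) * ‖F p.1 p.2 u'‖ := by
      refine Metric.mem_nhdsWithin_iff.2 ⟨r, hr0, ?_⟩
      rintro ⟨t, w⟩ ⟨hp, ht, hw⟩
      rw [Metric.mem_ball, Prod.dist_eq, Real.dist_eq, dist_eq_norm, max_lt_iff] at hp
      exact hdist t ht hp.1 w hw hp.2 u' (by rw [sub_self, norm_zero]; exact hε0.le)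
    exact tendsto_iff_norm_sub_tendsto_zero.2
      (squeeze_zero' (Eventually.of_forall fun _ => norm_nonneg _) hev h0)
  · intro t ht htr w₁ hw₁ w₂ hw₂ h₁ h₂
    have hb := hball t ht htr w₂ hw₂ h₂
    have h3 := hdist t ht htr w₁ hw₁ h₁ (φ t w₂) hb
    have h4 := hLip t ht (htr.trans_le hrrL) w₁ w₂ (h₁.trans_le hrrL) (h₂.trans_le hrrL) (φ t w₂)
      (hb.trans_lt hεr)
    rw [hφ t ht w₂ hw₂, sub_zero] at h4
    calc _ ≤ _ := h3
      _ ≤ κ / (1 - κ * q) * (L * ‖w₁ - w₂‖) := by gcongr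
      _ = _ := by ring

end Implicit

/-! ### Projectors of a root system and the inverse of `Ã` -/

namespace RootSystem

variable {𝕜 X Y : Type*} [RCLike 𝕜]
  [NormedAddCommGroup X] [NormedSpace 𝕜 X] [NormedAddCommGroup Y] [NormedSpace 𝕜 Y]
  {A B : X →ₗ.[𝕜] Y} {hAB : A.domain ≤ B.domain} (S : RootSystem A B hAB)

lemma P20_apply (x : A.domain) : S.P20 x = ∑ i, S.q i 1 (S.Bop x) • S.φ i 1 := by
  simp [P20]

lemma P2Sigma_apply (x : A.domain) :
    S.P2Sigma x = ∑ i, ∑ j ∈ Finset.Icc 2 (S.m i), S.q i j (S.Bop x) • S.φ i j := by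
  simp [P2Sigma]

lemma P1_apply (x : A.domain) : S.P1 x = x - (S.P20 x + S.P2Sigma x) := rfl

lemma Q2star_apply (y : Y) : S.Q2star y = ∑ i, S.q i (S.m i) y • S.Bop (S.φ i (S.m i)) := by
  simp [Q2star]

lemma Q2Sigma_apply (y : Y) :
    S.Q2Sigma y = ∑ i, ∑ j ∈ Finset.Ico 1 (S.m i), S.q i j y • S.Bop (S.φ i j) := by
  simp [Q2Sigma]

lemma Atilde_apply (x : A.domain) :
    S.Atilde x = A x + ∑ i, S.q i 1 (S.Bop x) • S.Bop (S.φ i (S.m i)) := by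
  simp [Atilde]

lemma q_Bop {i : Fin S.n} {j : ℕ} {k : Fin S.n} {l : ℕ} (hj : 1 ≤ j) (hjm : j ≤ S.m i)
    (hl : 1 ≤ l) (hlm : l ≤ S.m k) :
    S.q k l (S.Bop (S.φ i j)) = if i = k ∧ j = l then 1 else 0 :=
  S.biorthogonal i j k l hj hjm hl hlm

lemma apply_eigenvector (i : Fin S.n) : A (S.φ i 1) = 0 := by
  have : S.φ i 1 ∈ LinearMap.ker A.toFun :=
    S.span_eigenvectors ▸ Submodule.subset_span ⟨i, rfl⟩
  exact this

lemma q_sum_last (c : Fin S.n → 𝕜) (k : Fin S.n) {l : ℕ} (hl : 1 ≤ l) (hlm : l ≤ S.m k) :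
    S.q k l (∑ i, c i • S.Bop (S.φ i (S.m i))) = if S.m k = l then c k else 0 := by
  rw [map_sum]
  simp only [map_smul]
  rw [Finset.sum_eq_single k]
  · rw [S.q_Bop (S.one_le_m k) le_rfl hl hlm]
    simp
  · intro i _ hik
    rw [S.q_Bop (S.one_le_m i) le_rfl hl hlm, if_neg (fun h => hik h.1), smul_zero]
  · simp

lemma q_sum_first (c : Fin S.n → 𝕜) (k : Fin S.n) :
    S.q k 1 (S.Bop (∑ i, c i • S.φ i 1)) = c k := by
  rw [map_sum, map_sum]
  simp only [map_smul]
  rw [Finset.sum_eq_single k]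
  · rw [S.q_Bop le_rfl (S.one_le_m k) le_rfl (S.one_le_m k)]
    simp
  · intro i _ hik
    rw [S.q_Bop le_rfl (S.one_le_m i) le_rfl (S.one_le_m k), if_neg (fun h => hik h.1), smul_zero]
  · simp

lemma Q2star_eq_zero_iff {y : Y} : S.Q2star y = 0 ↔ ∀ i, S.q i (S.m i) y = 0 := by
  constructor
  · intro h k
    have := congrArg (S.q k (S.m k)) h
    rwa [Q2star_apply, S.q_sum_last _ k (S.one_le_m k) le_rfl, if_pos rfl, map_zero] at this
  · intro h
    rw [Q2star_apply]
    exact Finset.sum_eq_zero fun i _ => by rw [h i, zero_smul]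

lemma Q2star_mem (y : Y) : S.Q2star y ∈ S.Y2star := by
  rw [Q2star_apply]
  exact Submodule.sum_mem _ fun i _ => Submodule.smul_mem _ _ (Submodule.subset_span ⟨i, rfl⟩)

lemma continuous_Q2star : Continuous S.Q2star := by
  have : (S.Q2star : Y → Y) = fun y => ∑ i, S.q i (S.m i) y • S.Bop (S.φ i (S.m i)) :=
    funext S.Q2star_apply
  rw [this]
  fun_prop

/-- `W = Y_1 ∔ Y_2Σ` is the kernel of `Q_2*`. -/
lemma mem_W_iff {y : Y} : y ∈ S.W ↔ ∀ i, S.q i (S.m i) y = 0 := by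
  constructor
  · intro hy i
    obtain ⟨_, ⟨z, rfl⟩, v, hv, rfl⟩ := Submodule.mem_sup.1 hy
    have hv0 : ∀ v ∈ S.Y2Sigma, S.q i (S.m i) v = 0 := by
      intro v hv
      have hle : S.Y2Sigma ≤ LinearMap.ker (S.q i (S.m i) : Y →ₗ[𝕜] 𝕜) := by
        rw [Y2Sigma, Submodule.span_le]
        rintro _ ⟨k, j, hj, hjm, rfl⟩
        have := S.q_Bop hj hjm.le (S.one_le_m i) le_rfl
        rw [if_neg (by rintro ⟨rfl, rfl⟩; exact lt_irrefl _ hjm)] at this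
        exact this
      exact hle hv
    have hz : S.q i (S.m i) (S.Q1 z) = 0 := by
      have h1 : S.Q1 z = z - (S.Q2Sigma z + S.Q2star z) := rfl
      have h2 : S.Q2Sigma z ∈ S.Y2Sigma := by
        rw [Q2Sigma_apply]
        refine Submodule.sum_mem _ fun k _ => Submodule.sum_mem _ fun j hj =>
          Submodule.smul_mem _ _ (Submodule.subset_span ⟨k, j, ?_, ?_, rfl⟩)
        · exact (Finset.mem_Ico.1 hj).1
        · exact (Finset.mem_Ico.1 hj).2
      rw [h1, map_sub, map_add, hv0 _ h2, Q2star_apply, S.q_sum_last _ i (S.one_le_m i) le_rfl,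
        if_pos rfl, zero_add, sub_self]
    rw [map_add, hz, hv0 v hv, add_zero]
  · intro h
    have h0 : S.Q2star y = 0 := S.Q2star_eq_zero_iff.2 h
    have hdec : y = S.Q1 y + S.Q2Sigma y := by
      change y = y - (S.Q2Sigma y + S.Q2star y) + S.Q2Sigma y
      rw [h0]; abel
    rw [hdec]
    refine Submodule.add_mem_sup ⟨y, rfl⟩ ?_
    rw [Q2Sigma_apply]
    refine Submodule.sum_mem _ fun k _ => Submodule.sum_mem _ fun j hj =>
      Submodule.smul_mem _ _ (Submodule.subset_span ⟨k, j, ?_, ?_, rfl⟩)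
    · exact (Finset.mem_Ico.1 hj).1
    · exact (Finset.mem_Ico.1 hj).2

lemma isClosed_W : IsClosed (S.W : Set Y) := by
  have : (S.W : Set Y) = ⋂ i, {y | S.q i (S.m i) y = 0} := by
    ext y
    simp only [SetLike.mem_coe, mem_W_iff, mem_iInter, mem_ofPred_eq]
  rw [this]
  exact isClosed_iInter fun i => isClosed_eq (S.q i (S.m i)).continuous continuous_const

lemma apply_mem_W (x : A.domain) : A x ∈ S.W := S.mem_W_iff.2 fun i => S.adjoint_last i x

lemma q_Atilde (i : Fin S.n) (x : A.domain) :
    S.q i (S.m i) (S.Atilde x) = S.q i 1 (S.Bop x) := by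
  rw [Atilde_apply, map_add, S.adjoint_last, S.q_sum_last _ i (S.one_le_m i) le_rfl, if_pos rfl,
    zero_add]

lemma P20_mem (x : A.domain) : S.P20 x ∈ S.D20 := by
  rw [P20_apply]
  refine Submodule.sum_mem _ fun i _ => Submodule.smul_mem _ _ ?_
  exact S.apply_eigenvector i

lemma P2Sigma_mem (x : A.domain) : S.P2Sigma x ∈ S.D2Sigma := by
  rw [P2Sigma_apply]
  refine Submodule.sum_mem _ fun i _ => Submodule.sum_mem _ fun j hj =>
    Submodule.smul_mem _ _ (Submodule.subset_span ⟨i, j, ?_, ?_, rfl⟩)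
  · exact (Finset.mem_Icc.1 hj).1
  · exact (Finset.mem_Icc.1 hj).2

lemma P20_of_mem_D20 {x : A.domain} (hx : x ∈ S.D20) : S.P20 x = x := by
  have hx' : x ∈ Submodule.span 𝕜 (range fun i => S.φ i 1) := S.span_eigenvectors ▸ hx
  obtain ⟨c, rfl⟩ := (Submodule.mem_span_range_iff_exists_fun 𝕜).1 hx'
  rw [P20_apply]
  exact Finset.sum_congr rfl fun i _ => by rw [q_sum_first]

/-- If `Ã x ∈ W`, then `x` has no component in `ker A`. -/
lemma P20_eq_zero_of_mem {x : A.domain} (hx : S.Atilde x ∈ S.W) : S.P20 x = 0 := by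
  rw [P20_apply]
  refine Finset.sum_eq_zero fun i _ => ?_
  rw [← q_Atilde, S.mem_W_iff.1 hx, zero_smul]

lemma Atilde_eq_of_mem {x : A.domain} (hx : S.Atilde x ∈ S.W) : S.Atilde x = A x := by
  rw [Atilde_apply, add_eq_left]
  refine Finset.sum_eq_zero fun i _ => ?_
  rw [← q_Atilde, S.mem_W_iff.1 hx, zero_smul]

/-- `Ã` agrees with `A` on the range of `P_1 + P_2Σ = I - P_20`. -/
lemma Atilde_sub_P20 (x : A.domain) : S.Atilde (x - S.P20 x) = A x := by
  have h0 : ∀ i, S.q i 1 (S.Bop (x - S.P20 x)) = 0 := fun i => by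
    rw [map_sub, map_sub, P20_apply, q_sum_first, sub_self]
  rw [Atilde_apply]
  simp only [h0, zero_smul, Finset.sum_const_zero, add_zero]
  change A.toFun _ = A.toFun _
  rw [map_sub, sub_eq_self]
  exact S.P20_mem x

lemma P1_add_P2Sigma_apply (x : A.domain) : S.P1 x + S.P2Sigma x = x - S.P20 x := by
  rw [P1_apply]; abel

/-- `B P_1` has no component in `Y_2*`. -/
lemma Q2star_Bop_of_mem_D1 {x : A.domain} (hx : x ∈ S.D1) : S.Q2star (S.Bop x) = 0 := by
  obtain ⟨z, rfl⟩ := hx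
  rw [Q2star_eq_zero_iff]
  intro k
  have h20 : S.q k (S.m k) (S.Bop (S.P20 z)) =
      if S.m k = 1 then S.q k 1 (S.Bop z) else 0 := by
    rw [P20_apply, map_sum, map_sum]
    simp only [map_smul]
    rw [Finset.sum_eq_single k]
    · rw [S.q_Bop le_rfl (S.one_le_m k) (S.one_le_m k) le_rfl]
      simp [eq_comm]
    · intro i _ hik
      rw [S.q_Bop le_rfl (S.one_le_m i) (S.one_le_m k) le_rfl, if_neg (fun h => hik h.1), smul_zero]
    · simp
  have h2S : S.q k (S.m k) (S.Bop (S.P2Sigma z)) =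
      if S.m k = 1 then 0 else S.q k (S.m k) (S.Bop z) := by
    rw [P2Sigma_apply]
    simp only [map_sum, map_smul]
    have hq : ∀ i, ∀ j ∈ Finset.Icc 2 (S.m i), S.q k (S.m k) (S.Bop (S.φ i j)) =
        if i = k ∧ j = S.m k then 1 else 0 := fun i j hj =>
      S.q_Bop (by have := (Finset.mem_Icc.1 hj).1; omega) (Finset.mem_Icc.1 hj).2
        (S.one_le_m k) le_rfl
    rw [Finset.sum_eq_single k]
    · by_cases hm : S.m k = 1
      · rw [if_pos hm, hm]; rfl
      · have h2 : 2 ≤ S.m k := by have := S.one_le_m k; omega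
        rw [if_neg hm, Finset.sum_eq_single (S.m k)]
        · rw [hq k _ (Finset.mem_Icc.2 ⟨h2, le_rfl⟩)]; simp
        · intro j hj hjm
          rw [hq k j hj, if_neg (fun h => hjm h.2), smul_zero]
        · intro h; exact absurd (Finset.mem_Icc.2 ⟨h2, le_rfl⟩) h
    · intro i _ hik
      refine Finset.sum_eq_zero fun j hj => ?_
      rw [hq i j hj, if_neg (fun h => hik h.1), smul_zero]
    · simp
  rw [P1_apply, map_sub, map_add, map_sub, map_add, h20, h2S]
  by_cases hm : S.m k = 1
  · rw [if_pos hm, if_pos hm, hm, add_zero, sub_self]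
  · rw [if_neg hm, if_neg hm, zero_add, sub_self]

/-- `F_2*` is `Q_2* [f - B x]`, since `Q_2* B x_1 = 0`. -/
lemma F2star_eq (f : ℝ → A.domain → Y) (t : ℝ) {x1 : A.domain} (hx1 : x1 ∈ S.D1)
    (x2S x20 : A.domain) :
    S.F2star f t x1 x2S x20 =
      S.Q2star (f t (x1 + x2S + x20) - S.Bop (x1 + x2S + x20)) := by
  have h : S.Q2star (S.Bop (x1 + x2S + x20)) = S.Q2star (S.Bop (x20 + x2S)) := by
    rw [add_assoc, map_add, map_add, S.Q2star_Bop_of_mem_D1 hx1, zero_add, add_comm x2S]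
  rw [F2star, map_sub, h]

lemma Atilde_injective : Function.Injective S.Atilde := by
  refine (injective_iff_map_eq_zero S.Atilde).2 fun x hx => ?_
  have hW : S.Atilde x ∈ S.W := hx ▸ zero_mem _
  have hA : x ∈ S.D20 := by
    change A x = 0
    rw [← S.Atilde_eq_of_mem hW, hx]
  rw [← S.P20_of_mem_D20 hA, S.P20_eq_zero_of_mem hW]

lemma finrank_ker : Module.finrank 𝕜 (LinearMap.ker A.toFun) = S.n := by
  rw [← S.span_eigenvectors, finrank_span_eq_card S.linearIndependent_eigenvectors,
    Fintype.card_fin]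

/-- `Ã` is onto, since the vectors `B φ_i^(m_i)` span a complement of the range of `A`: they are
independent modulo this range, and their number is its codimension. -/
lemma Atilde_surjective [FiniteDimensional 𝕜 (Y ⧸ LinearMap.range A.toFun)]
    (hind : Module.finrank 𝕜 (Y ⧸ LinearMap.range A.toFun) =
      Module.finrank 𝕜 (LinearMap.ker A.toFun)) : Function.Surjective S.Atilde := by
  let v : Fin S.n → Y ⧸ LinearMap.range A.toFun :=
    fun i => Submodule.Quotient.mk (S.Bop (S.φ i (S.m i)))
  have hsum : ∀ c : Fin S.n → 𝕜, ∑ i, c i • v i =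
      Submodule.Quotient.mk (∑ i, c i • S.Bop (S.φ i (S.m i))) := fun c => by
    rw [← Submodule.mkQ_apply, map_sum]
    simp only [map_smul]
    rfl
  have hv : LinearIndependent 𝕜 v := by
    rw [Fintype.linearIndependent_iff]
    intro c hc k
    rw [hsum, Submodule.Quotient.mk_eq_zero] at hc
    obtain ⟨x, hx⟩ := hc
    have h1 := S.adjoint_last k x
    change S.q k (S.m k) (A.toFun x) = 0 at h1
    rwa [hx, S.q_sum_last _ k (S.one_le_m k) le_rfl, if_pos rfl] at h1
  have hspan := hv.span_eq_top_of_card_eq_finrank' (by rw [hind, S.finrank_ker, Fintype.card_fin])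
  intro y
  have hy : (Submodule.Quotient.mk y : Y ⧸ LinearMap.range A.toFun) ∈ Submodule.span 𝕜 (range v) :=
    hspan ▸ Submodule.mem_top
  obtain ⟨c, hc⟩ := (Submodule.mem_span_range_iff_exists_fun 𝕜).1 hy
  rw [hsum, eq_comm, Submodule.Quotient.eq] at hc
  obtain ⟨x, hx⟩ := hc
  -- `A x = y - ∑ c_i B φ_i^(m_i)`; the component of the preimage in `ker A` is adjusted to `c`
  refine ⟨(x - S.P20 x) + ∑ i, c i • S.φ i 1, ?_⟩
  have hker : (∑ i, c i • S.φ i 1 : A.domain) ∈ S.D20 :=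
    Submodule.sum_mem _ fun i _ => Submodule.smul_mem _ _ (S.apply_eigenvector i)
  have h2 : A (∑ i, c i • S.φ i 1 : A.domain) = 0 := hker
  rw [map_add, Atilde_sub_P20, S.Atilde_apply (∑ i, c i • S.φ i 1), h2, zero_add]
  simp only [q_sum_first]
  change A.toFun x + _ = y
  rw [hx]; abel

/-- `Ã` has a bounded inverse `K` for which `B K` is bounded as well, by the open mapping theorem
for `Ã` on the graph of `A`. -/
theorem exists_inverse_Atilde [CompleteSpace X] [CompleteSpace Y] (hA : A.IsClosed)
    (hB : B.IsClosed) (hbij : Function.Bijective S.Atilde) :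
    ∃ K : Y →L[𝕜] A.domain, (∀ y, S.Atilde (K y) = y) ∧ (∀ x, K (S.Atilde x) = x) ∧
      Continuous fun y => S.Bop (K y) := by
  have : CompleteSpace A.graph := IsClosed.completeSpace_coe (hs := hA)
  have hb : Continuous fun p : A.graph => S.Bop (graphToDomain A p) :=
    continuous_onDomain_graphToDomain hAB hA hB
  have hcont : Continuous (S.Atilde ∘ₗ graphToDomain A) := by
    have : ((S.Atilde ∘ₗ graphToDomain A : A.graph →ₗ[𝕜] Y) : A.graph → Y) =
        fun p => p.1.2 + ∑ i, S.q i 1 (S.Bop (graphToDomain A p)) • S.Bop (S.φ i (S.m i)) := by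
      funext p
      rw [LinearMap.comp_apply, Atilde_apply, apply_graphToDomain]
    rw [this]
    fun_prop
  have hginj : Function.Injective (graphToDomain A) := by
    intro p p' h
    refine Subtype.ext (Prod.ext (congrArg Subtype.val h) ?_)
    rw [← apply_graphToDomain, ← apply_graphToDomain, h]
  let G : A.graph →L[𝕜] Y := ⟨S.Atilde ∘ₗ graphToDomain A, hcont⟩
  have hGinj : Function.Injective G := hbij.1.comp hginj
  have hGsurj : Function.Surjective G := hbij.2.comp fun x => by
    obtain ⟨p, hp, -⟩ := graphToDomain_surjective A x
    exact ⟨p, hp⟩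
  let e : A.graph ≃L[𝕜] Y := ContinuousLinearEquiv.ofBijective G (LinearMap.ker_eq_bot.2 hGinj)
    (LinearMap.range_eq_top.2 hGsurj)
  have he : ∀ y, S.Atilde (graphToDomain A (e.symm y)) = y := fun y =>
    ContinuousLinearEquiv.ofBijective_apply_symm_apply G _ _ y
  have hg : Continuous (graphToDomain A) :=
    Continuous.subtype_mk (continuous_fst.comp continuous_subtype_val) _
  let K : Y →L[𝕜] A.domain :=
    ContinuousLinearMap.comp ⟨graphToDomain A, hg⟩ (e.symm : Y →L[𝕜] A.graph)
  refine ⟨K, he, fun x => hbij.1 (he _), ?_⟩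
  exact hb.comp e.symm.continuous

end RootSystem

/-! ### The condition on the derivative implies the contractivity condition -/

section Partial

variable {𝕜 D Y : Type*} [RCLike 𝕜] [NormedAddCommGroup D] [NormedSpace 𝕜 D]
  [NormedAddCommGroup Y] [NormedSpace 𝕜 Y] {f : ℝ → D → Y}

/-- The partial derivative at a point approximates the increments of `f(t, ·)` near this point. -/
lemma HasContinuousPartial.exists_approximation (h : HasContinuousPartial 𝕜 f) {t' : ℝ}
    (ht' : 0 ≤ t') (x' : D) {η : ℝ} (hη : 0 < η) :
    ∃ r : ℝ, 0 < r ∧ ∀ t : ℝ, 0 ≤ t → |t - t'| < r → ∀ x₁ x₂ : D, ‖x₁ - x'‖ < r → ‖x₂ - x'‖ < r →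
      ‖f t x₁ - f t x₂ - fderiv 𝕜 (f t') x' (x₁ - x₂)‖ ≤ η * ‖x₁ - x₂‖ := by
  obtain ⟨r, hr, hc⟩ := Metric.continuousOn_iff.1 h.2 (t', x') ⟨ht', mem_univ _⟩ η hη
  refine ⟨r, hr, fun t ht htr x₁ x₂ h₁ h₂ => ?_⟩
  let _ : NormedSpace ℝ D := NormedSpace.restrictScalars ℝ 𝕜 D
  refine Convex.norm_image_sub_le_of_norm_fderiv_le' (𝕜 := 𝕜) (s := Metric.ball x' r)
    (fun x _ => (h.1 t ht).differentiableAt) (fun x hx => ?_) (convex_ball x' r) ?_ ?_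
  · rw [← dist_eq_norm]
    refine (hc (t, x) ⟨ht, mem_univ _⟩ ?_).le
    rw [Prod.dist_eq, Real.dist_eq]
    exact max_lt htr hx
  · rwa [Metric.mem_ball, dist_eq_norm]
  · rwa [Metric.mem_ball, dist_eq_norm]

lemma HasContinuousPartial.locallyLipschitzInX (h : HasContinuousPartial 𝕜 f) :
    LocallyLipschitzInX f := by
  intro t' ht' x'
  obtain ⟨r, hr, happ⟩ := h.exists_approximation ht' x' one_pos
  refine ⟨r, ‖fderiv 𝕜 (f t') x'‖ + 1, hr, by positivity, fun t ht htr x₁ x₂ h₁ h₂ => ?_⟩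
  have h1 := happ t ht htr x₁ x₂ h₁ h₂
  have h2 := (fderiv 𝕜 (f t') x').le_opNorm (x₁ - x₂)
  calc ‖f t x₁ - f t x₂‖
      = ‖(f t x₁ - f t x₂ - fderiv 𝕜 (f t') x' (x₁ - x₂)) + fderiv 𝕜 (f t') x' (x₁ - x₂)‖ := by
        rw [sub_add_cancel]
    _ ≤ _ := norm_add_le _ _
    _ ≤ _ := by linarith

end Partial

namespace RootSystem

variable {𝕜 X Y : Type*} [RCLike 𝕜]
  [NormedAddCommGroup X] [NormedSpace 𝕜 X] [NormedAddCommGroup Y] [NormedSpace 𝕜 Y]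
  {A B : X →ₗ.[𝕜] Y} {hAB : A.domain ≤ B.domain} (S : RootSystem A B hAB)

lemma norm_Q2star_le (y : Y) :
    ‖S.Q2star y‖ ≤ ‖(⟨S.Q2star, S.continuous_Q2star⟩ : Y →L[𝕜] Y)‖ * ‖y‖ :=
  (⟨S.Q2star, S.continuous_Q2star⟩ : Y →L[𝕜] Y).le_opNorm y

lemma locallyContractive_of_derivInvertible {f : ℝ → A.domain → Y} {Mt : Set S.W}
    {M20 : Set A.domain} (hf : HasContinuousPartial 𝕜 f) (hD : S.DerivInvertible f Mt M20) :
    S.LocallyContractive f Mt M20 := by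
  intro t' x1' hx1' x2S' hx2S' x20' hx20' hM hL0
  obtain ⟨Wop, hWop⟩ := hD t' x1' hx1' x2S' hx2S' x20' hx20' hM hL0
  set c := ‖(⟨S.Q2star, S.continuous_Q2star⟩ : Y →L[𝕜] Y)‖ with hc
  have hc0 : 0 ≤ c := norm_nonneg _
  set κ := ‖(Wop.symm : S.Y2star →L[𝕜] S.D20)‖ with hκ
  have hκ0 : 0 ≤ κ := ContinuousLinearMap.opNorm_nonneg _
  set η : ℝ := 1 / (c * κ + 1) with hη
  have hη0 : 0 < η := by positivity
  obtain ⟨r, hr, happ⟩ := hf.exists_approximation hL0.1 (x1' + x2S' + x20') hη0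
  refine ⟨Wop, fun _ _ => c * η, c * η, r / 3, r / 3, by positivity, by positivity,
    tendsto_const_nhds, ?_, ?_⟩
  · have : c * η * κ = c * κ / (c * κ + 1) := by rw [hη]; ring
    rw [this, div_lt_one (by positivity)]
    linarith
  · intro δ hδ ε hε t ht htδ x1 _ h1 x2S _ h2 u v hu hv
    have hclose : ∀ z : A.domain, ‖z - x20'‖ < ε →
        ‖x1 + x2S + z - (x1' + x2S' + x20')‖ < r := by
      intro z hz
      have hsplit : x1 + x2S + z - (x1' + x2S' + x20') =
          (x1 - x1') + (x2S - x2S') + (z - x20') := by abel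
      rw [hsplit]
      have h3 := norm_add₃_le (a := x1 - x1') (b := x2S - x2S') (c := z - x20')
      linarith [hδ.2, hε.2]
    have h4 := happ t ht (by linarith [hδ.2]) _ _ (hclose u hu) (hclose v hv)
    have hdiff : x1 + x2S + (u : A.domain) - (x1 + x2S + (v : A.domain)) =
        ((u - v : S.D20) : A.domain) := by rw [Submodule.coe_sub]; abel
    rw [hdiff] at h4
    have h5 : S.F2star f t x1 x2S u - S.F2star f t x1 x2S v - (Wop (u - v) : Y) =
        S.Q2star (f t (x1 + x2S + u) - f t (x1 + x2S + v) -
          fderiv 𝕜 (f t') (x1' + x2S' + x20') ((u - v : S.D20) : A.domain)) := by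
      rw [hWop]
      simp only [F2star, map_add, map_sub, Submodule.coe_sub]
      abel
    rw [h5, mul_assoc]
    refine (S.norm_Q2star_le _).trans ?_
    rw [← hc]
    gcongr
    exact h4

end RootSystem

/-! ### The component in `ker A` as a function of the remaining components -/

namespace RootSystem

variable {𝕜 X Y : Type*} [RCLike 𝕜]
  [NormedAddCommGroup X] [NormedSpace 𝕜 X] [NormedAddCommGroup Y] [NormedSpace 𝕜 Y]
  {A B : X →ₗ.[𝕜] Y} {hAB : A.domain ≤ B.domain} (S : RootSystem A B hAB)
  {K : Y →L[𝕜] A.domain}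

lemma exists_component_bound (hBK : Continuous fun y => S.Bop (K y)) :
    ∃ c : ℝ, 0 ≤ c ∧ ∀ y, ‖S.P1 (K y)‖ ≤ c * ‖y‖ ∧ ‖S.P2Sigma (K y)‖ ≤ c * ‖y‖ := by
  have h2 : Continuous (S.P2Sigma ∘ₗ (K : Y →ₗ[𝕜] A.domain)) := by
    have : ((S.P2Sigma ∘ₗ (K : Y →ₗ[𝕜] A.domain) : Y →ₗ[𝕜] A.domain) : Y → A.domain) =
        fun y => ∑ i, ∑ j ∈ Finset.Icc 2 (S.m i), S.q i j (S.Bop (K y)) • S.φ i j :=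
      funext fun y => S.P2Sigma_apply (K y)
    rw [this]
    fun_prop
  have h20 : Continuous (S.P20 ∘ₗ (K : Y →ₗ[𝕜] A.domain)) := by
    have : ((S.P20 ∘ₗ (K : Y →ₗ[𝕜] A.domain) : Y →ₗ[𝕜] A.domain) : Y → A.domain) =
        fun y => ∑ i, S.q i 1 (S.Bop (K y)) • S.φ i 1 :=
      funext fun y => S.P20_apply (K y)
    rw [this]
    fun_prop
  have h1 : Continuous (S.P1 ∘ₗ (K : Y →ₗ[𝕜] A.domain)) := K.continuous.sub (h20.add h2)
  let T1 : Y →L[𝕜] A.domain := ⟨S.P1 ∘ₗ (K : Y →ₗ[𝕜] A.domain), h1⟩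
  let T2 : Y →L[𝕜] A.domain := ⟨S.P2Sigma ∘ₗ (K : Y →ₗ[𝕜] A.domain), h2⟩
  refine ⟨max ‖T1‖ ‖T2‖, (T1.opNorm_nonneg).trans (le_max_left _ _), fun y => ⟨?_, ?_⟩⟩
  · exact (T1.le_opNorm y).trans (by gcongr; exact le_max_left _ _)
  · exact (T2.le_opNorm y).trans (by gcongr; exact le_max_right _ _)

lemma inverse_mem_M12 (hK : ∀ y, S.Atilde (K y) = y) {Mt : Set S.W} {w : S.W} (hw : w ∈ Mt) :
    K w ∈ S.M12 Mt :=
  ⟨w, hw, hK w⟩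

lemma P1_add_P2Sigma_inverse (hK : ∀ y, S.Atilde (K y) = y) (w : S.W) :
    S.P1 (K w) + S.P2Sigma (K w) = K w := by
  rw [P1_add_P2Sigma_apply, S.P20_eq_zero_of_mem (by rw [hK]; exact w.2), sub_zero]

lemma apply_inverse (hK : ∀ y, S.Atilde (K y) = y) (w : S.W) : A (K w) = w := by
  rw [← S.Atilde_eq_of_mem (by rw [hK]; exact w.2), hK]

/-- `Q_2* [f - B x]` at `x = K w + u` as a map to `Y_2*`. -/
def residual (K : Y →L[𝕜] A.domain) (f : ℝ → A.domain → Y) (t : ℝ) (w : S.W) (u : S.D20) :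
    S.Y2star :=
  ⟨S.Q2star (f t (K w + u) - S.Bop (K w + u)), S.Q2star_mem _⟩

lemma residual_eq_zero_iff {f : ℝ → A.domain → Y} {t : ℝ} (ht : 0 ≤ t) (w : S.W) (u : S.D20) :
    S.residual K f t w u = 0 ↔ (t, K w + (u : A.domain)) ∈ S.L0 f := by
  rw [← Submodule.coe_eq_zero]
  exact ⟨fun h => ⟨ht, h⟩, fun h => h.2⟩

/-- The residual is `F_2*` at the components of `K w`. -/
lemma coe_residual (hK : ∀ y, S.Atilde (K y) = y) (f : ℝ → A.domain → Y) (t : ℝ) (w : S.W)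
    (u : S.D20) :
    (S.residual K f t w u : Y) = S.F2star f t (S.P1 (K w)) (S.P2Sigma (K w)) u := by
  rw [S.F2star_eq f t ⟨K w, rfl⟩, S.P1_add_P2Sigma_inverse hK]
  rfl

lemma continuousOn_state {f : ℝ → A.domain → Y} {s : Set (ℝ × S.W)} (hs : s ⊆ Ici 0 ×ˢ univ)
    (hf : ContinuousOn (fun p : ℝ × A.domain => f p.1 p.2) (Ici 0 ×ˢ univ))
    (hBK : Continuous fun y => S.Bop (K y)) [FiniteDimensional 𝕜 S.D20] {φ : ℝ × S.W → S.D20}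
    (hφ : ContinuousOn φ s) :
    ContinuousOn (fun p : ℝ × S.W => f p.1 (K p.2 + (φ p : A.domain)) -
      S.Bop (K p.2 + (φ p : A.domain))) s := by
  have hcφ : ContinuousOn (fun p => (φ p : A.domain)) s :=
    continuous_subtype_val.comp_continuousOn hφ
  have hcK : Continuous fun p : ℝ × S.W => K (p.2 : Y) :=
    K.continuous.comp (continuous_subtype_val.comp continuous_snd)
  have h1 : ContinuousOn (fun p : ℝ × S.W => f p.1 (K p.2 + (φ p : A.domain))) s :=
    hf.comp (f := fun p : ℝ × S.W => (p.1, K p.2 + (φ p : A.domain)))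
      (continuous_fst.continuousOn.prodMk (hcK.continuousOn.add hcφ))
      (fun p hp => ⟨(hs hp).1, mem_univ _⟩)
  have hB : Continuous (S.Bop ∘ₗ S.D20.subtype) := LinearMap.continuous_of_finiteDimensional _
  have h2 : ContinuousOn (fun p : ℝ × S.W => S.Bop (K p.2 + (φ p : A.domain))) s := by
    simp only [map_add]
    exact (hBK.comp (continuous_subtype_val.comp continuous_snd)).continuousOn.add
      (hB.comp_continuousOn hφ)
  exact h1.sub h2

/-- The constraint `Q_2* [f - B x] = 0` is solved by a function `φ` of `t` and `w = Ã (x_1 + x_2Σ)`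
that is continuous and locally Lipschitz in `w`. The contraction principle gives a solution near
each point of the constraint manifold; relative openness places it in `M_20`, where solutions are
unique. -/
theorem exists_implicit_function [FiniteDimensional 𝕜 S.D20] (hK : ∀ y, S.Atilde (K y) = y)
    (hBK : Continuous fun y => S.Bop (K y)) {f : ℝ → A.domain → Y}
    (hf : ContinuousOn (fun p : ℝ × A.domain => f p.1 p.2) (Ici 0 ×ˢ univ))
    {Mt : Set S.W} {M20 : Set A.domain} (hM20 : M20 ⊆ S.D20)
    (huniq : S.UniquelySolvable f Mt M20) (hopen : S.RelativelyOpen f Mt M20)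
    (hlip : LocallyLipschitzInX f) (hcontr : S.LocallyContractive f Mt M20) :
    ∃ φ : ℝ → S.W → S.D20,
      (∀ t, 0 ≤ t → ∀ w ∈ Mt, (φ t w : A.domain) ∈ M20 ∧ (t, K w + (φ t w : A.domain)) ∈ S.L0 f) ∧
      (∀ t, 0 ≤ t → ∀ w ∈ Mt, ∀ u ∈ M20, (t, K w + u) ∈ S.L0 f → u = φ t w) ∧
      ContinuousOn (fun p : ℝ × S.W => φ p.1 p.2) (Ici 0 ×ˢ Mt) ∧
      ∀ t', 0 ≤ t' → ∀ w' ∈ Mt, ∃ r L : ℝ, 0 < r ∧ 0 ≤ L ∧ ∀ t, 0 ≤ t → |t - t'| < r →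
        ∀ w₁ ∈ Mt, ∀ w₂ ∈ Mt, ‖w₁ - w'‖ < r → ‖w₂ - w'‖ < r →
        ‖φ t w₁ - φ t w₂‖ ≤ L * ‖w₁ - w₂‖ := by
  have hex : ∀ t : ℝ, 0 ≤ t → ∀ w ∈ Mt, ∃ u : S.D20,
      ((u : A.domain) ∈ M20 ∧ (t, K w + (u : A.domain)) ∈ S.L0 f) ∧
      ∀ v ∈ M20, (t, K w + v) ∈ S.L0 f → v = u := by
    intro t ht w hw
    obtain ⟨u, hu, hu'⟩ := huniq t ht (K w) (S.inverse_mem_M12 hK hw)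
    exact ⟨⟨u, hM20 hu.1⟩, hu, fun v hv hv' => hu' v ⟨hv, hv'⟩⟩
  choose! φ hφ hφu using hex
  have : CompleteSpace S.D20 := FiniteDimensional.complete 𝕜 S.D20
  obtain ⟨c, hc0, hc⟩ := S.exists_component_bound hBK
  -- points `w` close to `w'` have close components `P_1 K w` and `P_2Σ K w`
  have hclose : ∀ {ρ : ℝ} {w w' : S.W}, 0 < ρ → ‖w - w'‖ < ρ / (c + 1) →
      ‖S.P1 (K w) - S.P1 (K w')‖ < ρ ∧ ‖S.P2Sigma (K w) - S.P2Sigma (K w')‖ < ρ := by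
    intro ρ w w' hρ h
    have h1 := hc ((w : Y) - w')
    have h2 : c * ‖(w : Y) - w'‖ < ρ := by
      have h3 : ‖(w : Y) - w'‖ < ρ / (c + 1) := h
      rw [lt_div_iff₀ (by positivity)] at h3
      have := norm_nonneg ((w : Y) - w')
      linarith
    rw [map_sub, map_sub, map_sub] at h1
    exact ⟨h1.1.trans_lt h2, h1.2.trans_lt h2⟩
  have key : ∀ t', 0 ≤ t' → ∀ w' ∈ Mt,
      ContinuousWithinAt (fun p : ℝ × S.W => φ p.1 p.2) (Ici 0 ×ˢ Mt) (t', w') ∧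
      ∃ r L : ℝ, 0 < r ∧ 0 ≤ L ∧ ∀ t, 0 ≤ t → |t - t'| < r → ∀ w₁ ∈ Mt, ∀ w₂ ∈ Mt,
        ‖w₁ - w'‖ < r → ‖w₂ - w'‖ < r → ‖φ t w₁ - φ t w₂‖ ≤ L * ‖w₁ - w₂‖ := by
    intro t' ht' w' hw'
    have hsum := S.P1_add_P2Sigma_inverse hK w'
    have hM' : S.P1 (K w') + S.P2Sigma (K w') ∈ S.M12 Mt := by
      rw [hsum]; exact S.inverse_mem_M12 hK hw'
    have hL0' : (t', S.P1 (K w') + S.P2Sigma (K w') + (φ t' w' : A.domain)) ∈ S.L0 f := by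
      rw [hsum]; exact (hφ t' ht' w' hw').2
    refine implicit_function_lipschitz (𝕜 := 𝕜) (F := S.residual K f) ht' hw'
      (fun t ht w hw => (S.residual_eq_zero_iff ht w _).2 (hφ t ht w hw).2) ?_ ?_ ?_ ?_
    · obtain ⟨r, hr, hop⟩ := hopen t' _ ⟨K w', rfl⟩ _ (S.P2Sigma_mem (K w')) _
        (hφ t' ht' w' hw').1 hM' hL0'
      refine ⟨min r (r / (c + 1)), by positivity, fun t ht htr w hw hwr u hu hu0 => ?_⟩
      have hmem : (t, K w + (u : A.domain)) ∈ S.L0 f := (S.residual_eq_zero_iff ht w u).1 hu0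
      have hcl := hclose hr (hwr.trans_le (min_le_right _ _))
      have hsw := S.P1_add_P2Sigma_inverse hK w
      have huM : (u : A.domain) ∈ M20 :=
        hop t _ ⟨K w, rfl⟩ _ (S.P2Sigma_mem (K w)) u u.2 (hsw.symm ▸ S.inverse_mem_M12 hK hw)
          (by rw [hsw]; exact hmem) (htr.trans_le (min_le_left _ _)) hcl.1 hcl.2
          (hu.trans_le (min_le_left _ _))
      exact Subtype.ext (hφu t ht w hw u huM hmem)
    · have h1 := S.continuousOn_state (K := K) (s := Ici 0 ×ˢ Mt) (φ := fun _ => φ t' w')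
        (prod_mono_right (subset_univ _)) hf hBK continuousOn_const
      have h2 := S.continuous_Q2star.comp_continuousOn h1
      have h3 : ContinuousOn (fun p : ℝ × S.W => S.residual K f p.1 p.2 (φ t' w'))
          (Ici 0 ×ˢ Mt) :=
        Topology.IsInducing.subtypeVal.continuousOn_iff.2 h2
      exact h3 (t', w') ⟨ht', hw'⟩
    · obtain ⟨r, L, hr, hL, hlip⟩ := hlip t' ht' (K w' + (φ t' w' : A.domain))
      let BK : Y →L[𝕜] Y := ⟨S.Bop ∘ₗ (K : Y →ₗ[𝕜] A.domain), hBK⟩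
      set Q : Y →L[𝕜] Y := ⟨S.Q2star, S.continuous_Q2star⟩ with hQ
      have hn0 : 0 ≤ ‖K‖ := K.opNorm_nonneg
      have hQ0 : 0 ≤ ‖Q‖ := Q.opNorm_nonneg
      have hB0 : 0 ≤ ‖BK‖ := BK.opNorm_nonneg
      have hKn : ∀ y : Y, ‖K y‖ ≤ ‖K‖ * ‖y‖ := K.le_opNorm
      refine ⟨min (r / 2) (r / 2 / (‖K‖ + 1)), ‖Q‖ * (L * ‖K‖ + ‖BK‖), by positivity, by positivity,
        fun t ht htr w₁ w₂ h₁ h₂ u hu => ?_⟩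
      have htr' : |t - t'| < r := by linarith [htr.trans_le (min_le_left _ _)]
      have hnear : ∀ w : S.W, ‖w - w'‖ < min (r / 2) (r / 2 / (‖K‖ + 1)) →
          ‖K w + (u : A.domain) - (K w' + (φ t' w' : A.domain))‖ < r := by
        intro w hw
        have h1 : ‖(w : Y) - w'‖ < r / 2 / (‖K‖ + 1) := hw.trans_le (min_le_right _ _)
        rw [lt_div_iff₀ (by positivity)] at h1
        have h2 : ‖(u : A.domain) - (φ t' w' : A.domain)‖ < r / 2 := hu.trans_le (min_le_left _ _)
        have h3 := hKn ((w : Y) - w')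
        have hsplit : K w + (u : A.domain) - (K w' + (φ t' w' : A.domain)) =
            K ((w : Y) - w') + ((u : A.domain) - (φ t' w' : A.domain)) := by
          rw [map_sub]; abel
        rw [hsplit]
        have h4 := norm_add_le (K ((w : Y) - w')) ((u : A.domain) - (φ t' w' : A.domain))
        have := norm_nonneg ((w : Y) - w')
        linarith
      have hfl := hlip t ht htr' _ _ (hnear w₁ h₁) (hnear w₂ h₂)
      have hKsub : K w₁ + (u : A.domain) - (K w₂ + (u : A.domain)) = K ((w₁ : Y) - w₂) := by
        rw [map_sub]; abel
      rw [hKsub] at hfl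
      have hres : ((S.residual K f t w₁ u - S.residual K f t w₂ u : S.Y2star) : Y) =
          Q (f t (K w₁ + u) - f t (K w₂ + u) - BK ((w₁ : Y) - w₂)) := by
        change S.Q2star _ - S.Q2star _ = S.Q2star (_ - S.Bop (K ((w₁ : Y) - w₂)))
        rw [← hKsub]
        simp only [map_sub, map_add]
        abel
      change ‖((S.residual K f t w₁ u - S.residual K f t w₂ u : S.Y2star) : Y)‖ ≤
        _ * ‖(w₁ : Y) - w₂‖
      rw [hres]
      calc _ ≤ ‖Q‖ * ‖f t (K w₁ + u) - f t (K w₂ + u) - BK ((w₁ : Y) - w₂)‖ := Q.le_opNorm _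
        _ ≤ ‖Q‖ * (L * (‖K‖ * ‖(w₁ : Y) - w₂‖) + ‖BK‖ * ‖(w₁ : Y) - w₂‖) := by
          gcongr
          refine (norm_sub_le _ _).trans (add_le_add (hfl.trans ?_) (BK.le_opNorm _))
          gcongr
          exact hKn _
        _ = _ := by ring
    · obtain ⟨Wop, q, l, δ₀, ε₀, hδ₀, hε₀, hq, hl, happ⟩ := hcontr t' _ ⟨K w', rfl⟩ _
        (S.P2Sigma_mem (K w')) _ (hφ t' ht' w' hw').1 hM' hL0'
      set κ := ‖(Wop.symm : S.Y2star →L[𝕜] S.D20)‖ with hκ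
      have hκ0 : 0 ≤ κ := ContinuousLinearMap.opNorm_nonneg _
      have hev : ∀ᶠ p : ℝ × ℝ in 𝓝[>] 0 ×ˢ 𝓝[>] 0,
          q p.1 p.2 * κ < 1 ∧ p.1 ∈ Ioc 0 δ₀ ∧ p.2 ∈ Ioc 0 ε₀ :=
        ((hq.mul_const κ).eventually_lt_const hl).and
          ((Eventually.prod_inl (Ioc_mem_nhdsGT hδ₀) _).and
            (Eventually.prod_inr (Ioc_mem_nhdsGT hε₀) _))
      obtain ⟨⟨δ, ε⟩, hqκ, hδ, hε⟩ := hev.exists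
      simp only at hqκ hδ hε
      have hδ0 := hδ.1
      have hε0 := hε.1
      refine ⟨Wop, max (q δ ε) 0, min (min δ ε) (δ / (c + 1)), by positivity, le_max_right _ _, ?_,
        fun t ht htr w hw hwr u v hu hv => ?_⟩
      · rw [← hκ, mul_comm, max_mul_of_nonneg _ _ hκ0, zero_mul]
        exact max_lt hqκ one_pos
      · have hmδ : min (min δ ε) (δ / (c + 1)) ≤ δ := (min_le_left _ _).trans (min_le_left _ _)
        have hmε : min (min δ ε) (δ / (c + 1)) ≤ ε := (min_le_left _ _).trans (min_le_right _ _)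
        have hcl := hclose hδ0 (hwr.trans_le (min_le_right _ _))
        have h := happ δ hδ ε hε t ht (htr.trans_le hmδ) _ ⟨K w, rfl⟩ hcl.1 _
          (S.P2Sigma_mem (K w)) hcl.2 u v (hu.trans_le hmε) (hv.trans_le hmε)
        rw [← S.coe_residual hK, ← S.coe_residual hK] at h
        calc _ ≤ q δ ε * ‖u - v‖ := h
          _ ≤ _ := by gcongr; exact le_max_left _ _
  exact ⟨φ, hφ, hφu, fun p hp => (key p.1 hp.1 p.2 hp.2).1,
    fun t' ht' w' hw' => (key t' ht' w' hw').2⟩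

end RootSystem

/-! ### Reduction to an ordinary differential equation -/

namespace RootSystem

variable {𝕜 X Y : Type*} [RCLike 𝕜]
  [NormedAddCommGroup X] [NormedSpace 𝕜 X] [NormedAddCommGroup Y] [NormedSpace 𝕜 Y]
  {A B : X →ₗ.[𝕜] Y} {hAB : A.domain ≤ B.domain} (S : RootSystem A B hAB)
  {K : Y →L[𝕜] A.domain}

/-- The projection `I - Q_2*` of `Y` onto `W`. -/
def toW : Y →L[𝕜] S.W where
  toFun y := ⟨y - S.Q2star y, S.mem_W_iff.2 fun i => by
    rw [map_sub, Q2star_apply, S.q_sum_last _ i (S.one_le_m i) le_rfl, if_pos rfl, sub_self]⟩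
  map_add' y z := Subtype.ext (by simp only [map_add, Submodule.coe_add]; abel)
  map_smul' c y := Subtype.ext (by
    simp only [map_smul, RingHom.id_apply, Submodule.coe_smul, smul_sub])
  cont := Continuous.subtype_mk (continuous_id.sub S.continuous_Q2star) _

lemma toW_of_mem (w : S.W) : S.toW w = w := by
  refine Subtype.ext ?_
  change (w : Y) - S.Q2star w = w
  rw [S.Q2star_eq_zero_iff.2 (S.mem_W_iff.1 w.2), sub_zero]

lemma coe_toW_of_Q2star_eq_zero {y : Y} (hy : S.Q2star y = 0) : (S.toW y : Y) = y := by
  change y - S.Q2star y = y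
  rw [hy, sub_zero]

/-- The vector field of the inherent ordinary differential equation for `w = A x` in `W`, where
`x = K w + φ(t, w)`. -/
def reducedField (K : Y →L[𝕜] A.domain) (f : ℝ → A.domain → Y) (φ : ℝ → S.W → S.D20) (t : ℝ)
    (w : S.W) : S.W :=
  S.toW (f t (K w + φ t w) - S.Bop (K w + φ t w))

lemma reducedField_locallyLipschitz [FiniteDimensional 𝕜 S.D20]
    (hBK : Continuous fun y => S.Bop (K y)) {f : ℝ → A.domain → Y} (hlip : LocallyLipschitzInX f)
    {Mt : Set S.W} {φ : ℝ → S.W → S.D20}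
    (hφc : ContinuousOn (fun p : ℝ × S.W => φ p.1 p.2) (Ici 0 ×ˢ Mt))
    (hφl : ∀ t', 0 ≤ t' → ∀ w' ∈ Mt, ∃ r L : ℝ, 0 < r ∧ 0 ≤ L ∧ ∀ t, 0 ≤ t → |t - t'| < r →
        ∀ w₁ ∈ Mt, ∀ w₂ ∈ Mt, ‖w₁ - w'‖ < r → ‖w₂ - w'‖ < r →
        ‖φ t w₁ - φ t w₂‖ ≤ L * ‖w₁ - w₂‖) :
    LocallyLipschitzInState (S.reducedField K f φ) Mt := by
  intro t' ht' w' hw'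
  obtain ⟨r₁, L₁, hr₁, hL₁, hφl⟩ := hφl t' ht' w' hw'
  obtain ⟨r₂, L₂, hr₂, hL₂, hlip⟩ := hlip t' ht' (K w' + (φ t' w' : A.domain))
  have hcx : ContinuousOn (fun p : ℝ × S.W => K p.2 + (φ p.1 p.2 : A.domain)) (Ici 0 ×ˢ Mt) :=
    (K.continuous.comp (continuous_subtype_val.comp continuous_snd)).continuousOn.add
      (continuous_subtype_val.comp_continuousOn hφc)
  obtain ⟨r₃, hr₃, hcx⟩ := Metric.continuousOn_iff.1 hcx (t', w') ⟨ht', hw'⟩ r₂ hr₂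
  let BK : Y →L[𝕜] Y := ⟨S.Bop ∘ₗ (K : Y →ₗ[𝕜] A.domain), hBK⟩
  let Bφ : S.D20 →L[𝕜] Y := LinearMap.toContinuousLinearMap (S.Bop ∘ₗ S.D20.subtype)
  have hn0 : 0 ≤ ‖K‖ := K.opNorm_nonneg
  have hB0 : 0 ≤ ‖BK‖ := BK.opNorm_nonneg
  have hBφ0 : 0 ≤ ‖Bφ‖ := Bφ.opNorm_nonneg
  have hW0 : 0 ≤ ‖S.toW‖ := S.toW.opNorm_nonneg
  set r := min (min r₁ r₂) r₃ with hr
  have hrr₁ : r ≤ r₁ := (min_le_left _ _).trans (min_le_left _ _)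
  have hrr₂ : r ≤ r₂ := (min_le_left _ _).trans (min_le_right _ _)
  have hrr₃ : r ≤ r₃ := min_le_right _ _
  refine ⟨r, ‖S.toW‖ * (L₂ * (‖K‖ + L₁) + (‖BK‖ + ‖Bφ‖ * L₁)), by positivity, by positivity,
    fun t ht htr w₁ hw₁ w₂ hw₂ h₁ h₂ => ?_⟩
  have hnear : ∀ w ∈ Mt, ‖w - w'‖ < r →
      ‖K w + (φ t w : A.domain) - (K w' + (φ t' w' : A.domain))‖ < r₂ := by
    intro w hw hwr
    have := hcx (t, w) ⟨ht, hw⟩ (by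
      rw [Prod.dist_eq, Real.dist_eq, dist_eq_norm]
      exact max_lt (htr.trans_le hrr₃) (hwr.trans_le hrr₃))
    rwa [dist_eq_norm] at this
  have hfl := hlip t ht (htr.trans_le hrr₂) _ _ (hnear w₁ hw₁ h₁) (hnear w₂ hw₂ h₂)
  have hφ12 := hφl t ht (htr.trans_le hrr₁) w₁ hw₁ w₂ hw₂ (h₁.trans_le hrr₁) (h₂.trans_le hrr₁)
  have hKn : ‖K ((w₁ : Y) - w₂)‖ ≤ ‖K‖ * ‖w₁ - w₂‖ := K.le_opNorm _
  have hBn : ‖BK ((w₁ : Y) - w₂)‖ ≤ ‖BK‖ * ‖w₁ - w₂‖ := BK.le_opNorm _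
  have hx : ‖K w₁ + (φ t w₁ : A.domain) - (K w₂ + (φ t w₂ : A.domain))‖ ≤
      (‖K‖ + L₁) * ‖w₁ - w₂‖ := by
    have hsplit : K w₁ + (φ t w₁ : A.domain) - (K w₂ + (φ t w₂ : A.domain)) =
        K ((w₁ : Y) - w₂) + ((φ t w₁ - φ t w₂ : S.D20) : A.domain) := by
      rw [map_sub, Submodule.coe_sub]; abel
    rw [hsplit, add_mul]
    exact (norm_add_le _ _).trans (add_le_add hKn hφ12)
  have hB : ‖BK ((w₁ : Y) - w₂) + Bφ (φ t w₁ - φ t w₂)‖ ≤ (‖BK‖ + ‖Bφ‖ * L₁) * ‖w₁ - w₂‖ := by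
    rw [add_mul, mul_assoc]
    refine (norm_add_le _ _).trans (add_le_add hBn ((Bφ.le_opNorm _).trans ?_))
    gcongr
  have hdiff : S.reducedField K f φ t w₁ - S.reducedField K f φ t w₂ =
      S.toW ((f t (K w₁ + φ t w₁) - f t (K w₂ + φ t w₂)) -
        (BK ((w₁ : Y) - w₂) + Bφ (φ t w₁ - φ t w₂))) := by
    rw [reducedField, reducedField, ← map_sub]
    congr 1
    change _ = _ - (S.Bop (K ((w₁ : Y) - w₂)) + S.Bop ((φ t w₁ - φ t w₂ : S.D20) : A.domain))
    simp only [map_sub, map_add, Submodule.coe_sub]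
    abel
  rw [hdiff]
  calc _ ≤ ‖S.toW‖ * ‖(f t (K w₁ + φ t w₁) - f t (K w₂ + φ t w₂)) -
        (BK ((w₁ : Y) - w₂) + Bφ (φ t w₁ - φ t w₂))‖ := S.toW.le_opNorm _
    _ ≤ ‖S.toW‖ * (L₂ * ((‖K‖ + L₁) * ‖w₁ - w₂‖) + (‖BK‖ + ‖Bφ‖ * L₁) * ‖w₁ - w₂‖) := by
      gcongr
      refine (norm_sub_le _ _).trans (add_le_add (hfl.trans ?_) hB)
      gcongr
    _ = _ := by ring

variable [NormedSpace ℝ Y]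

/-- A solution satisfies the constraint at all times other than an isolated initial time: `A x` has
its values in the kernel of `Q_2*`, so the same holds for its derivative. -/
lemma mem_L0_of_isSolutionOn [IsScalarTower ℝ 𝕜 Y] {f : ℝ → A.domain → Y} {J : Set ℝ}
    {x : ℝ → A.domain} (h : IsSolutionOn A B hAB f J x) {t : ℝ} (ht : t ∈ J) (ht0 : 0 ≤ t)
    (hJ : UniqueDiffWithinAt ℝ J t) : (t, x t) ∈ S.L0 f := by
  obtain ⟨-, v, -, hv⟩ := h
  obtain ⟨hder, heq⟩ := hv t ht
  have hfB : f t (x t) - S.Bop (x t) = v t := by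
    rw [← heq]
    exact add_sub_cancel_right _ _
  refine ⟨ht0, ?_⟩
  change S.Q2star (f t (x t) - S.Bop (x t)) = 0
  rw [hfB]
  let Q : Y →L[ℝ] Y := (⟨S.Q2star, S.continuous_Q2star⟩ : Y →L[𝕜] Y).restrictScalars ℝ
  have h1 : HasDerivWithinAt (fun s => Q (A (x s))) (Q (v t)) J t :=
    Q.hasFDerivAt.comp_hasDerivWithinAt t hder
  have h2 : (fun s => Q (A (x s))) = fun _ => 0 := by
    funext s
    exact S.Q2star_eq_zero_iff.2 (S.mem_W_iff.1 (S.apply_mem_W (x s)))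
  rw [h2] at h1
  exact hJ.eq_deriv J h1 (hasDerivWithinAt_const t J 0)

/-- The differential-algebraic problem has unique maximal solutions under the contractivity
condition: `x` is a solution if and only if `w = A x` solves the inherent equation in `W` and
`x = K w + φ(t, w)`. -/
theorem hasUniqueMaximalSolution_of_contractive [IsScalarTower ℝ 𝕜 Y] [CompleteSpace Y]
    [FiniteDimensional 𝕜 S.D20] (hK : ∀ y, S.Atilde (K y) = y) (hK' : ∀ x, K (S.Atilde x) = x)
    (hBK : Continuous fun y => S.Bop (K y)) {f : ℝ → A.domain → Y}
    (hf : ContinuousOn (fun p : ℝ × A.domain => f p.1 p.2) (Ici 0 ×ˢ univ))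
    {Mt : Set S.W} {M20 : Set A.domain} (hMt : IsOpen Mt) (hM20 : M20 ⊆ S.D20)
    (huniq : S.UniquelySolvable f Mt M20) (hopen : S.RelativelyOpen f Mt M20)
    (hlip : LocallyLipschitzInX f) (hcontr : S.LocallyContractive f Mt M20)
    {t₀ : ℝ} {x₀ : A.domain} (hL0 : (t₀, x₀) ∈ S.L0 f) (hx₀ : (S.P1 + S.P2Sigma) x₀ ∈ S.M12 Mt)
    (hx₀' : S.P20 x₀ ∈ M20) :
    HasUniqueMaximalSolution A B hAB f (S.Msum Mt M20) t₀ x₀ := by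
  obtain ⟨φ, hφ, hφu, hφc, hφl⟩ :=
    S.exists_implicit_function hK hBK hf hM20 huniq hopen hlip hcontr
  have hstate := S.continuousOn_state (K := K) (prod_mono_right (subset_univ Mt)) hf hBK hφc
  have hgc : ContinuousOn (fun p : ℝ × S.W => S.reducedField K f φ p.1 p.2) (Ici 0 ×ˢ Mt) :=
    S.toW.continuous.comp_continuousOn hstate
  have hgl := S.reducedField_locallyLipschitz hBK hlip hφc hφl
  have : CompleteSpace S.W := S.isClosed_W.completeSpace_coe
  have ht₀ : 0 ≤ t₀ := hL0.1
  -- a point of the constraint manifold with components in the given sets is `K w + φ(t, w)`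
  have hrec : ∀ t, 0 ≤ t → ∀ x : A.domain, (t, x) ∈ S.L0 f → x ∈ S.Msum Mt M20 →
      (⟨A x, S.apply_mem_W x⟩ : S.W) ∈ Mt ∧
        x = K (A x) + φ t ⟨A x, S.apply_mem_W x⟩ := by
    rintro t ht x hx ⟨a, ⟨w, hw, haw⟩, b, hb, rfl⟩
    have hAb : A b = 0 := hM20 hb
    have hAab : A (a + b) = w := by
      rw [LinearPMap.map_add, hAb, add_zero, ← S.Atilde_eq_of_mem (haw ▸ w.2), haw]
    have hKa : K w = a := by rw [← haw, hK']
    have hwe : (⟨A (a + b), S.apply_mem_W _⟩ : S.W) = w := Subtype.ext hAab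
    rw [hwe, hAab]
    refine ⟨hw, ?_⟩
    rw [← hφu t ht w hw b hb (hKa.symm ▸ hx), hKa]
  have hx₀M : x₀ ∈ S.Msum Mt M20 := ⟨_, hx₀, _, hx₀', by
    rw [LinearMap.add_apply, P1_add_P2Sigma_apply, sub_add_cancel]⟩
  obtain ⟨hw₀, hx₀e⟩ := hrec t₀ ht₀ x₀ hL0 hx₀M
  obtain ⟨T, w, hT, hw, hwt₀, hmax⟩ := exists_maximal_ode_solution hMt hgc hgl ht₀ hw₀
  set J₀ := {t : ℝ | t₀ ≤ t ∧ (t : EReal) < T} with hJ₀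
  have hAx : ∀ t, A (K (w t) + (φ t (w t) : A.domain)) = w t := fun t => by
    have h0 : A (φ t (w t) : A.domain) = 0 := (φ t (w t)).2
    rw [LinearPMap.map_add, h0, add_zero, S.apply_inverse hK]
  have hcurve : MapsTo (fun t => (t, w t)) J₀ (Ici 0 ×ˢ Mt) := fun t ht =>
    ⟨ht₀.trans ht.1, (hw t ht).1⟩
  have hcurvec : ContinuousOn (fun t => (t, w t)) J₀ := continuousOn_id.prodMk hw.continuousOn
  refine ⟨T, fun t => K (w t) + (φ t (w t) : A.domain), hT, ⟨?_, ?_⟩, ?_, ?_, ?_⟩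
  · refine continuous_subtype_val.comp_continuousOn ?_
    exact (K.continuous.comp_continuousOn (continuous_subtype_val.comp_continuousOn
      hw.continuousOn)).add (continuous_subtype_val.comp_continuousOn (hφc.comp hcurvec hcurve))
  · refine ⟨fun t => f t (K (w t) + (φ t (w t) : A.domain)) -
      S.Bop (K (w t) + (φ t (w t) : A.domain)), hstate.comp hcurvec hcurve, fun t ht => ⟨?_, ?_⟩⟩
    · have h1 := (hw t ht).2
      have h2 : HasDerivWithinAt (fun s => (w s : Y))
          ((S.reducedField K f φ t (w t) : S.W) : Y) J₀ t :=
        (S.W.subtypeL.restrictScalars ℝ).hasFDerivAt.comp_hasDerivWithinAt t h1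
      rw [reducedField, S.coe_toW_of_Q2star_eq_zero
        (hφ t (ht₀.trans ht.1) (w t) (hw t ht).1).2.2] at h2
      simpa only [hAx] using h2
    · exact sub_add_cancel _ _
  · simp only [hwt₀]
    exact hx₀e.symm
  · intro t ht htT
    have hwt := (hw t ⟨ht, htT⟩).1
    exact ⟨_, S.inverse_mem_M12 hK hwt, _, (hφ t (ht₀.trans ht) _ hwt).1, rfl⟩
  · intro J y hJ ht₀J hJge hy hy₀ hyM
    have hyL0 : ∀ t ∈ J, (t, y t) ∈ S.L0 f := by
      intro t ht
      rcases (mem_Ici.1 (hJge ht)).eq_or_lt with rfl | hlt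
      · rw [hy₀]; exact hL0
      · exact S.mem_L0_of_isSolutionOn hy ht (ht₀.trans hlt.le)
          ((uniqueDiffOn_Icc hlt t ⟨hlt.le, le_rfl⟩).mono (hJ.out ht₀J ht))
    have hyrec := fun t (ht : t ∈ J) => hrec t (ht₀.trans (hJge ht)) (y t) (hyL0 t ht) (hyM t ht)
    set wy : ℝ → S.W := fun t => ⟨A (y t), S.apply_mem_W (y t)⟩ with hwy
    have hwysol : IsODESolutionOn (S.reducedField K f φ) Mt J wy := by
      intro t ht
      refine ⟨(hyrec t ht).1, ?_⟩
      obtain ⟨-, v, -, hv⟩ := hy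
      obtain ⟨hder, heq⟩ := hv t ht
      have h1 : HasDerivWithinAt (fun s => S.toW (A (y s))) (S.toW (v t)) J t :=
        (S.toW.restrictScalars ℝ).hasFDerivAt.comp_hasDerivWithinAt t hder
      have h2 : (fun s => S.toW (A (y s))) = wy := funext fun s => S.toW_of_mem (wy s)
      have h3 : S.toW (v t) = S.reducedField K f φ t (wy t) := by
        rw [reducedField]
        have hye : K (wy t) + (φ t (wy t) : A.domain) = y t := (hyrec t ht).2.symm
        rw [hye, ← heq]
        exact congrArg S.toW (add_sub_cancel_right _ _).symm
      rwa [h2, h3] at h1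
    obtain ⟨hsub, heq⟩ := hmax J wy hJ ht₀J hJge hwysol (Subtype.ext (by
      change A (y t₀) = A x₀
      rw [hy₀]))
    refine ⟨hsub, fun t ht => ?_⟩
    have hye : y t = K (wy t) + (φ t (wy t) : A.domain) := (hyrec t ht).2
    rw [hye, heq ht]

end RootSystem

end ADAE

theorem mainTheorem1 {𝕜 X Y : Type*} [RCLike 𝕜]
    [NormedAddCommGroup X] [NormedSpace 𝕜 X] [CompleteSpace X]
    [NormedAddCommGroup Y] [NormedSpace 𝕜 Y] [CompleteSpace Y]
    [NormedSpace ℝ Y] [IsScalarTower ℝ 𝕜 Y]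
    (A B : X →ₗ.[𝕜] Y) (hA : A.IsClosed) (hB : B.IsClosed)
    (hAdense : Dense (A.domain : Set X)) (hBdense : Dense (B.domain : Set X))
    (hrange : IsClosed (LinearMap.range A.toFun : Set Y))
    (hAB : A.domain ≤ B.domain) (hD : A.domain ≠ ⊥)
    (hker : FiniteDimensional 𝕜 (LinearMap.ker A.toFun))
    (ν : ℕ) (hν : ADAE.IsRegularPencilOfIndex A B ν) :
    -- canonical systems of root vectors exist, and the claims hold for each of them
    Nonempty (ADAE.RootSystem A B hAB) ∧
    ∀ (S : ADAE.RootSystem A B hAB) (f : ℝ → A.domain → Y),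
      ContinuousOn (fun p : ℝ × A.domain => f p.1 p.2) (Ici 0 ×ˢ univ) →
      -- the theorem, with the Lipschitz and contractivity conditions,
      -- and its version with a continuous derivative
      (∀ (Mt : Set S.W) (M20 : Set A.domain), IsOpen Mt → M20 ⊆ S.D20 →
        S.UniquelySolvable f Mt M20 → S.RelativelyOpen f Mt M20 →
        ((ADAE.LocallyLipschitzInX f ∧ S.LocallyContractive f Mt M20) ∨
          (ADAE.HasContinuousPartial 𝕜 f ∧ S.DerivInvertible f Mt M20)) →
        ∀ (t₀ : ℝ) (x₀ : A.domain), (t₀, x₀) ∈ S.L0 f →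
          (S.P1 + S.P2Sigma) x₀ ∈ S.M12 Mt → S.P20 x₀ ∈ M20 →
          ADAE.HasUniqueMaximalSolution A B hAB f (S.Msum Mt M20) t₀ x₀) ∧
      -- the whole-space case
      (S.UniquelySolvable f univ S.D20 →
        ((ADAE.LocallyLipschitzInX f ∧ S.LocallyContractive f univ S.D20) ∨
          (ADAE.HasContinuousPartial 𝕜 f ∧ S.DerivInvertible f univ S.D20)) →
        ∀ (t₀ : ℝ) (x₀ : A.domain), (t₀, x₀) ∈ S.L0 f →
          ADAE.HasUniqueMaximalSolution A B hAB f univ t₀ x₀) := by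
  refine ⟨ADAE.nonempty_rootSystem hA hB hAB hrange hker hν, fun S f hf => ?_⟩
  obtain ⟨hfin, hind⟩ := ADAE.finrank_quotient_range_of_regular hA hB hAB hrange hker hν
  have hD20 : FiniteDimensional 𝕜 S.D20 := hker
  obtain ⟨K, hK, hK', hBK⟩ :=
    S.exists_inverse_Atilde hA hB ⟨S.Atilde_injective, S.Atilde_surjective hind⟩
  have main : ∀ (Mt : Set S.W) (M20 : Set A.domain), IsOpen Mt → M20 ⊆ S.D20 →
      S.UniquelySolvable f Mt M20 → S.RelativelyOpen f Mt M20 →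
      ((ADAE.LocallyLipschitzInX f ∧ S.LocallyContractive f Mt M20) ∨
        (ADAE.HasContinuousPartial 𝕜 f ∧ S.DerivInvertible f Mt M20)) →
      ∀ (t₀ : ℝ) (x₀ : A.domain), (t₀, x₀) ∈ S.L0 f →
        (S.P1 + S.P2Sigma) x₀ ∈ S.M12 Mt → S.P20 x₀ ∈ M20 →
        ADAE.HasUniqueMaximalSolution A B hAB f (S.Msum Mt M20) t₀ x₀ := by
    intro Mt M20 hMt hM20 huniq hopen hcond t₀ x₀ hL0 hx₀ hx₀'
    obtain ⟨hlip, hcontr⟩ : ADAE.LocallyLipschitzInX f ∧ S.LocallyContractive f Mt M20 := by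
      rcases hcond with h | ⟨hp, hd⟩
      · exact h
      · exact ⟨hp.locallyLipschitzInX, S.locallyContractive_of_derivInvertible hp hd⟩
    exact S.hasUniqueMaximalSolution_of_contractive hK hK' hBK hf hMt hM20 huniq hopen hlip hcontr
      hL0 hx₀ hx₀'
  refine ⟨main, fun huniq hcond t₀ x₀ hL0 => ?_⟩
  -- for `M̃ = W` and `M_20 = ker A` every `x ∈ D` has its components in the given sets
  have hM12 : ∀ x : A.domain, (S.P1 + S.P2Sigma) x ∈ S.M12 univ := fun x =>
    ⟨⟨A x, S.apply_mem_W x⟩, mem_univ _, by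
      rw [LinearMap.add_apply, S.P1_add_P2Sigma_apply, S.Atilde_sub_P20]⟩
  have hMsum : S.Msum univ (S.D20 : Set A.domain) = univ := eq_univ_of_forall fun x =>
    ⟨_, hM12 x, S.P20 x, S.P20_mem x, by
      rw [LinearMap.add_apply, S.P1_add_P2Sigma_apply, sub_add_cancel]⟩
  have h := main univ S.D20 isOpen_univ subset_rfl huniq
    (fun _ _ _ _ _ _ _ _ _ => ⟨1, one_pos, fun _ _ _ _ _ x20 hx20 _ _ _ _ _ _ => hx20⟩)
    hcond t₀ x₀ hL0 (hM12 x₀) (S.P20_mem x₀)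
  rwa [hMsum] at h
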